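/- **Setting.** Let $X\in\mathbb{R}^{n\times p}$ be a fixed design with normalized columns ($\frac1n\sum_i X_{ij}^2=1$ for all $j$), $\Sigma=\frac1n X^\top X$, and $y=X\beta^*+\varepsilon$, where $\beta^*\neq0$ has support $S^*$ with $s=|S^*|$ and the $\varepsilon_i$ are i.i.d. with $\mathbb{E}e^{t\varepsilon_i}\le e^{\sigma^2t^2/2}$ for all $t$ ($\sigma>0$). One observes $y$ and $Z=X\circ M$ (elementwise product), where $M$ is independent of $\varepsilon$ and its rows are i.i.d. with mean $\mu_M$, covariance $\Sigma_M$ and sub-Gaussian parameter $\tau^2$; missing data is a special case. Assume, for constants $c_X,c_M$ and $m,\mu_0>0$, that $|X_{ij}|\le c_X$, $|M_{ij}|\le c_M$ almost surely, $(\Sigma_M+\mu_M\mu_M^\top)_{jk}\ge m$ (which holds for instance if $(\Sigma_M)_{jk}\ge m$) and $(\mu_M)_j\ge\mu_0$ for all indices. Fix $\hat\epsilon>0$. Let $\hat\Sigma$ be $\frac1nZ^\top Z$ divided elementwise by $\Sigma_M+\mu_M\mu_M^\top$, and $\hat\xi$ be $\frac1nZ^\top y$ divided elementwise by $\mu_M$.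 With an eigenvalue decomposition $\hat\Sigma=P\,\mathrm{Diag}(\theta_i)P^\top$ put $\tilde\Sigma=P\,\mathrm{Diag}(\max(\theta_i,\hat\epsilon))P^\top$, $\tilde Z=\sqrt n\,P\,\mathrm{Diag}(\sqrt{\max(\theta_i,\hat\epsilon)})P^\top$ and $\tilde y=\sqrt n\,P\,\mathrm{Diag}(1/\sqrt{\max(\theta_i,\hat\epsilon)})P^\top\hat\xi$. *Algorithm.* Given $a>1$ and $\lambda>0$, let $\rho_0=1$ and $w^0\in[0,\frac12]^p$. For $k=1,2,\dots$ let $\beta^k$ minimize $\frac1{2n}\|\tilde Z\beta-\tilde y\|^2+\lambda\sum_i(1-w_i^{k-1})|\beta_i|$ over $\beta\in\mathbb{R}^p$; choose $\rho_k\ge\rho_{k-1}$ if $k\le3$ and $\rho_k=\rho_{k-1}$ if $k>3$; and let $w_i^k$ minimize $\phi(t)-\rho_kt|\beta_i^k|$ over $t\in[0,1]$, where $\phi(t)=\frac{a-1}{a+1}t^2+\frac2{a+1}t$. Let $\beta^{\rm LS}$ minimize $\frac1{2n}\|\tilde Z\beta-\tilde y\|^2$ over the $\beta$ supported in $S^*$.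 *Constants.* Let $\Sigma_M^\dagger$ be the elementwise inverse of $\Sigma_M+\mu_M\mu_M^\top$, $\|\cdot\|_{\max}$ the largest absolute value of an entry, and $$\tilde K=2\big[\hat\epsilon-\min(\lambda_{\min}(\Sigma_M^\dagger),0)\,c_M^2\big]\|\beta^*\|_1,$$ $$\tilde K'=\tilde K\max\!\big(2,\,1+s\|\tilde\Sigma_{(S^*)^cS^*}\tilde\Sigma_{S^*S^*}^{-1}\|_{\max}\big),\qquad \tilde K''=\tilde K\,s\,\|\tilde\Sigma_{S^*S^*}^{-1}\|_{\max}.$$ **Corollary 4.** Suppose that $\Sigma$ satisfies the $\kappa$-restricted eigenvalue condition: $\kappa>0$ and $\beta^\top\Sigma\beta\ge\kappa\|\beta\|^2$ for every $\beta$ such that $\|\beta_{S^c}\|_1\le3\|\beta_S\|_1$ for some $S\supseteq S^*$ with $|S|\le1.5s$. Then, with probability at least $$1-Cp^2\exp(-c\,n\,s^{-2}\zeta^{-1}),$$ the following holds for all choices in the algorithm with $$\lambda\ge6\tilde K',\qquad \rho_1>\max\Big(\frac{4a}{(a+1)\min_{i\in S^*}|\beta_i^*|},\ \frac{5\kappa\tilde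 K''}{8\lambda}\Big),\qquad \rho_3\le\sqrt{\frac{5\kappa}{18\sqrt3\,\lambda}}:$$ $\beta^k=\beta^{\rm LS}$ and $\mathrm{sign}(\beta^k)=\mathrm{sign}(\beta^*)$ for all $k>\hat k$, where $$\hat k=\max\Big(1,\Big\lceil\frac{0.5\ln s}{\ln[(9\sqrt3-4)5\kappa\lambda^{-1}]-\ln[147\sqrt3\,\rho_3^2]}\Big\rceil\Big).$$ Here $C,c>0$ are universal constants and $\zeta>0$ is a function only of the nonzero entries of $\beta^*$, $\tau^2$, $\sigma^2$, $\kappa$, $\lambda_{\min}(\Sigma_M^\dagger)$, $c_X$, $c_M$, $m$, $\mu_0$ and $\hat\epsilon$. -/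

import Mathlib

open scoped Matrix NNReal
open MeasureTheory ProbabilityTheory

noncomputable section

/-! ### Matrix notation -/

/-- Elementwise maximum norm `max_{i,j} |A i j|` (equal to `0` for an empty matrix). -/
def maxNorm {m n : Type*} (A : Matrix m n ℝ) : ℝ := ⨆ ij : m × n, |A ij.1 ij.2|

/-- Smallest eigenvalue of a (nonempty) real symmetric matrix. -/
def lamMin {p : ℕ} (A : Matrix (Fin p) (Fin p) ℝ) : ℝ := sInf (spectrum ℝ A)

/-- `Σ = (1/n) Xᵀ X`. -/
def gram {n p : ℕ} (X : Matrix (Fin n) (Fin p) ℝ) : Matrix (Fin p) (Fin p) ℝ :=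
  (1 / (n : ℝ)) • (Xᵀ * X)

/-! ### Sparsity and the restricted eigenvalue condition -/

/-- The support `S*` of a vector. -/
def supp {p : ℕ} (b : Fin p → ℝ) : Finset (Fin p) := Finset.univ.filter fun i => b i ≠ 0

/-- The multiset of the nonzero entries of a vector (it carries no trace of the dimension). -/
def nonzeroEntries {p : ℕ} (b : Fin p → ℝ) : Multiset ℝ := (supp b).val.map b

/-- `min_{i ∈ S*} |b i|`. -/
def minAbs {p : ℕ} (b : Fin p → ℝ) : ℝ := ⨅ i : supp b, |b i|

/-- The set `𝒞(S*)`: the union over `S ⊇ S*` with `|S| ≤ 1.5 |S*|` of the cones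
`‖b_{Sᶜ}‖₁ ≤ 3 ‖b_S‖₁`. -/
def coneSet {p : ℕ} (Sstar : Finset (Fin p)) : Set (Fin p → ℝ) :=
  {b | ∃ S : Finset (Fin p), Sstar ⊆ S ∧ (S.card : ℝ) ≤ 1.5 * (Sstar.card : ℝ) ∧
    ∑ i ∈ Sᶜ, |b i| ≤ 3 * ∑ i ∈ S, |b i|}

/-- The `κ`-restricted eigenvalue condition for `A` on `𝒞(S*)`. -/
def REC {p : ℕ} (A : Matrix (Fin p) (Fin p) ℝ) (Sstar : Finset (Fin p)) (κ : ℝ) : Prop :=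
  0 < κ ∧ ∀ b ∈ coneSet Sstar, κ * ∑ i, b i ^ 2 ≤ b ⬝ᵥ (A *ᵥ b)

/-! ### Surrogates for multiplicative errors, and their calibration -/

/-- `Σ_M + μ_M μ_Mᵀ`, the matrix of second moments of a row of `M`. -/
def secondMoment {p : ℕ} (SM : Matrix (Fin p) (Fin p) ℝ) (muM : Fin p → ℝ) :
    Matrix (Fin p) (Fin p) ℝ := SM + Matrix.vecMulVec muM muM

/-- `Σ_M†`, the elementwise inverse of `Σ_M + μ_M μ_Mᵀ`. -/
def sigmaDagger {p : ℕ} (SM : Matrix (Fin p) (Fin p) ℝ) (muM : Fin p → ℝ) :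
    Matrix (Fin p) (Fin p) ℝ := Matrix.of fun j k => 1 / secondMoment SM muM j k

/-- `Σ̂_mul`: `(1/n) Zᵀ Z` divided elementwise by `Σ_M + μ_M μ_Mᵀ`. -/
def sigmaHat {n p : ℕ} (Z : Matrix (Fin n) (Fin p) ℝ) (SM : Matrix (Fin p) (Fin p) ℝ)
    (muM : Fin p → ℝ) : Matrix (Fin p) (Fin p) ℝ :=
  Matrix.of fun j k => gram Z j k / secondMoment SM muM j k

/-- `ξ̂_mul`: `(1/n) Zᵀ y` divided elementwise by `μ_M`. -/
def xiHat {n p : ℕ} (Z : Matrix (Fin n) (Fin p) ℝ) (y : Fin n → ℝ) (muM : Fin p → ℝ) :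
    Fin p → ℝ :=
  fun j => (1 / (n : ℝ)) * (Zᵀ *ᵥ y) j / muM j

/-- For symmetric `A = P Diag(θ) Pᵀ`, the projection `P Diag(max(θᵢ, ε)) Pᵀ` of `A` onto
`{W : W - ε I is positive semidefinite}`; `cfc f A` is `P Diag(f θᵢ) Pᵀ`. -/
def calSigma {p : ℕ} (A : Matrix (Fin p) (Fin p) ℝ) (ε : ℝ) : Matrix (Fin p) (Fin p) ℝ :=
  cfc (fun t : ℝ => max t ε) A

/-- `Z̃ = √n P Diag(√max(θᵢ, ε)) Pᵀ` for symmetric `A = P Diag(θ) Pᵀ`. -/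
def calZ (n : ℕ) {p : ℕ} (A : Matrix (Fin p) (Fin p) ℝ) (ε : ℝ) : Matrix (Fin p) (Fin p) ℝ :=
  √(n : ℝ) • cfc (fun t : ℝ => √(max t ε)) A

/-- `ỹ = √n P Diag(1/√max(θᵢ, ε)) Pᵀ ξ` for symmetric `A = P Diag(θ) Pᵀ`. -/
def calY (n : ℕ) {p : ℕ} (A : Matrix (Fin p) (Fin p) ℝ) (ε : ℝ) (ξ : Fin p → ℝ) : Fin p → ℝ :=
  √(n : ℝ) • (cfc (fun t : ℝ => 1 / √(max t ε)) A *ᵥ ξ)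

/-! ### The multi-stage convex relaxation algorithm and the oracle estimator -/

/-- The calibrated loss `(1/(2n)) ‖Z̃ b - ỹ‖²`. -/
def lsLoss (n : ℕ) {p : ℕ} (Zt : Matrix (Fin p) (Fin p) ℝ) (yt b : Fin p → ℝ) : ℝ :=
  1 / (2 * (n : ℝ)) * ∑ i, ((Zt *ᵥ b) i - yt i) ^ 2

/-- `φ(t) = (a-1)/(a+1) t² + 2/(a+1) t`. -/
def phi (a t : ℝ) : ℝ := (a - 1) / (a + 1) * t ^ 2 + 2 / (a + 1) * t

/-- `(b, w, ρ)` is a run (without stopping) of the multi-stage convex relaxation algorithm with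
data `(Z̃, ỹ)`, parameter `lam` and function `φ` of parameter `a`: `b k`, `k ≥ 1`, are the iterates
`βᵏ`, and `w k`, `ρ k`, `k ≥ 0`, the weights and penalty parameters. The value `b 0` plays no
role. -/
structure IsRun (n : ℕ) {p : ℕ} (Zt : Matrix (Fin p) (Fin p) ℝ) (yt : Fin p → ℝ) (lam a : ℝ)
    (b w : ℕ → Fin p → ℝ) (ρ : ℕ → ℝ) : Prop where
  lam_pos : 0 < lam
  a_gt : 1 < a
  rho_zero : ρ 0 = 1
  w_zero : ∀ i, 0 ≤ w 0 i ∧ w 0 i ≤ 1 / 2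
  beta_step : ∀ k, 1 ≤ k → ∀ v : Fin p → ℝ,
    lsLoss n Zt yt (b k) + lam * ∑ i, (1 - w (k - 1) i) * |b k i| ≤
      lsLoss n Zt yt v + lam * ∑ i, (1 - w (k - 1) i) * |v i|
  rho_step : ∀ k, 1 ≤ k → k ≤ 3 → ρ (k - 1) ≤ ρ k
  rho_const : ∀ k, 3 < k → ρ k = ρ (k - 1)
  w_mem : ∀ k, 1 ≤ k → ∀ i, w k i ∈ Set.Icc (0 : ℝ) 1
  w_step : ∀ k, 1 ≤ k → ∀ i, ∀ t ∈ Set.Icc (0 : ℝ) 1,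
    phi a (w k i) - ρ k * w k i * |b k i| ≤ phi a t - ρ k * t * |b k i|

/-- `bLS` is an oracle least squares solution: a minimizer of the calibrated loss among the vectors
supported in `Sstar`. -/
structure IsOracleLS (n : ℕ) {p : ℕ} (Zt : Matrix (Fin p) (Fin p) ℝ) (yt : Fin p → ℝ)
    (Sstar : Finset (Fin p)) (bLS : Fin p → ℝ) : Prop where
  supp_subset : supp bLS ⊆ Sstar
  le : ∀ v : Fin p → ℝ, supp v ⊆ Sstar → lsLoss n Zt yt bLS ≤ lsLoss n Zt yt v

/-! ### The constants of the result -/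

/-- `K̃ = 2 [ε - min(λ_min(Σ_M†), 0) c_M²] ‖β*‖₁`. -/
def Ktilde {p : ℕ} (bstar : Fin p → ℝ) (SM : Matrix (Fin p) (Fin p) ℝ) (muM : Fin p → ℝ)
    (cM ε : ℝ) : ℝ :=
  2 * (ε - min (lamMin (sigmaDagger SM muM)) 0 * cM ^ 2) * ∑ i, |bstar i|

/-- `[A]_{S S}⁻¹`. -/
def blockInv {p : ℕ} (A : Matrix (Fin p) (Fin p) ℝ) (S : Finset (Fin p)) :
    Matrix {i // i ∈ S} {i // i ∈ S} ℝ := (A.toBlock (· ∈ S) (· ∈ S))⁻¹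

/-- `G = [A]_{Sᶜ S} [A]_{S S}⁻¹`. -/
def Gmat {p : ℕ} (A : Matrix (Fin p) (Fin p) ℝ) (S : Finset (Fin p)) :
    Matrix {i // i ∉ S} {i // i ∈ S} ℝ := A.toBlock (· ∉ S) (· ∈ S) * blockInv A S

/-- `K̃' = K̃ max(2, 1 + s ‖G‖_max)` with `G` formed from the calibrated matrix `A`. -/
def Kprime {p : ℕ} (A : Matrix (Fin p) (Fin p) ℝ) (S : Finset (Fin p)) (K : ℝ) : ℝ :=
  K * max 2 (1 + (S.card : ℝ) * maxNorm (Gmat A S))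

/-- `K̃'' = K̃ s ‖[A]_{S S}⁻¹‖_max` with `A` the calibrated matrix. -/
def Kdoubleprime {p : ℕ} (A : Matrix (Fin p) (Fin p) ℝ) (S : Finset (Fin p)) (K : ℝ) : ℝ :=
  K * (S.card : ℝ) * maxNorm (blockInv A S)

/-- The iteration count
`k̂ = max(1, ⌈0.5 ln s / (ln[(9√3 - 4) 5κ/λ] - ln[147 √3 ρ₃²])⌉)`. -/
def kHat (s : ℕ) (κ lam ρ₃ : ℝ) : ℕ :=
  max 1 ⌈0.5 * Real.log s /
    (Real.log ((9 * √3 - 4) * 5 * κ * lam⁻¹) - Real.log (147 * √3 * ρ₃ ^ 2))⌉₊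

/-! ### The statistical model -/

/-- Linear regression `y = X β* + e` with a fixed design `X` observed under multiplicative errors,
`Z = X ∘ M`. `M i` is the `i`-th row of the error matrix and `e i` the `i`-th noise variable. -/
structure MulErrorModel {Ω : Type*} [MeasurableSpace Ω] (P : Measure Ω) {n p : ℕ}
    (X : Matrix (Fin n) (Fin p) ℝ) (M : Fin n → Ω → Fin p → ℝ) (e : Fin n → Ω → ℝ)
    (muM : Fin p → ℝ) (SM : Matrix (Fin p) (Fin p) ℝ) (τ σ : ℝ≥0) (cX cM m μ₀ : ℝ) : Prop where
  /-- the columns of the design are normalized -/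
  normalized : ∀ j, 1 / (n : ℝ) * ∑ i, X i j ^ 2 = 1
  /-- the noise variables are i.i.d. sub-Gaussian with parameter `σ²` -/
  e_meas : ∀ i, Measurable (e i)
  e_indep : iIndepFun e P
  e_ident : ∀ i i', IdentDistrib (e i) (e i') P P
  sigma_pos : 0 < σ
  e_subG : ∀ i, HasSubgaussianMGF (e i) (σ ^ 2) P
  /-- the rows of `M` are i.i.d. with mean `muM`, covariance `SM`, sub-Gaussian parameter `τ²` -/
  M_meas : ∀ i, Measurable (M i)
  M_indep : iIndepFun M P
  M_ident : ∀ i i', IdentDistrib (M i) (M i') P P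
  M_mean : ∀ i j, ∫ ω, M i ω j ∂P = muM j
  M_cov : ∀ i j k, covariance (fun ω => M i ω j) (fun ω => M i ω k) P = SM j k
  M_subG : ∀ i, ∀ u : Fin p → ℝ, u ⬝ᵥ u = 1 →
    HasSubgaussianMGF (fun ω => u ⬝ᵥ (M i ω - muM)) (τ ^ 2) P
  /-- the measurement errors are independent of the noise -/
  indep : IndepFun (fun ω i => M i ω) (fun ω i => e i ω) P
  /-- boundedness and nondegeneracy. The lower bound `m` on the second moments holds in particular
  if `m` bounds the entries of `SM` from below. -/
  X_bdd : ∀ i j, |X i j| ≤ cX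
  M_bdd : ∀ᵐ ω ∂P, ∀ i j, |M i ω j| ≤ cM
  m_pos : 0 < m
  m_le : ∀ j k, m ≤ secondMoment SM muM j k
  mu_pos : 0 < μ₀
  mu_le : ∀ j, μ₀ ≤ muM j

/-- The corrupted design `Z = X ∘ M` at the outcome `ω`. -/
def corrupted {Ω : Type*} {n p : ℕ} (X : Matrix (Fin n) (Fin p) ℝ) (M : Fin n → Ω → Fin p → ℝ)
    (ω : Ω) : Matrix (Fin n) (Fin p) ℝ := X ⊙ Matrix.of fun i j => M i ω j

/-- The response `y = X β* + e` at the outcome `ω`. -/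
def response {Ω : Type*} {n p : ℕ} (X : Matrix (Fin n) (Fin p) ℝ) (bstar : Fin p → ℝ)
    (e : Fin n → Ω → ℝ) (ω : Ω) : Fin n → ℝ := fun i => (X *ᵥ bstar) i + e i ω

/-- What the result asserts at the outcome with observed data `(Z, y)`: for all admissible choices
of the parameters, for every run of the algorithm and every oracle solution, the iterates after
`k̂` steps are the oracle solution and have the signs of `β*`. -/
def EventuallyOracle {n p : ℕ} (Z : Matrix (Fin n) (Fin p) ℝ) (y : Fin n → ℝ)
    (bstar : Fin p → ℝ) (muM : Fin p → ℝ) (SM : Matrix (Fin p) (Fin p) ℝ) (cM ε κ : ℝ) : Prop :=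
  let A := sigmaHat Z SM muM
  let St := calSigma A ε
  let Zt := calZ n A ε
  let yt := calY n A ε (xiHat Z y muM)
  let S := supp bstar
  let K := Ktilde bstar SM muM cM ε
  ∀ (lam a : ℝ) (b w : ℕ → Fin p → ℝ) (ρ : ℕ → ℝ) (bLS : Fin p → ℝ),
    IsRun n Zt yt lam a b w ρ → IsOracleLS n Zt yt S bLS →
    6 * Kprime St S K ≤ lam →
    max (4 * a / ((a + 1) * minAbs bstar)) (5 * κ * Kdoubleprime St S K / (8 * lam)) < ρ 1 →
    ρ 3 ≤ √(5 * κ / (18 * √3 * lam)) →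
    ∀ k, kHat S.card κ lam (ρ 3) < k →
      b k = bLS ∧ ∀ i, SignType.sign (b k i) = SignType.sign (bstar i)

end

/-! ### Quadratic losses and weighted `ℓ₁` penalties -/

/-! Up to a constant, the calibrated loss is the strongly convex quadratic with matrix `H =
calSigma` and linear term `ξ = xiHat`. The proof separates a deterministic argument about this
quadratic from one good event on which it applies. The event does not depend on λ, `a`, the run or
the oracle solution, so all choices are covered at once.

Deterministic part. Call a weight wrong if it is below `1` on the support S or above `1/2` off S.
Optimality of one stage, the restricted eigenvalue condition and Cauchy–Schwarz bound the squared
distance to the oracle solution by a multiple of the number of wrong weights used in that stage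
(`stage_error_le`). Conversely, each wrong new weight forces an error of order `1/ρ` in its
coordinate (`card_weight_errors_le`). Hence the number of wrong weights shrinks geometrically. It
starts at most `s` and is an integer, so once the bound falls below `1` it is zero, and then the
next iterate equals the oracle solution. `pow_kHat_mul_lt_one` checks that `kHat` stages suffice.
The normal equations on S (`oracle_bounds`) give the residual and error bounds for the oracle that
this needs.

Calibration. Raising the eigenvalues to ε only increases the quadratic form, so a restricted
eigenvalue bound for `sigmaHat` survives. It moves each entry by at most `ε - l`, where `l` is a
lower bound on the spectrum of `sigmaHat` supplied by `le_dotProduct_sigmaHat`.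

Probability. Entries of `sigmaHat` and `xiHat` concentrate by Hoeffding's inequality and a
conditional sub-Gaussian bound. Entrywise accuracy of order `1/s` costs only half of κ, because
`‖u‖₁² ≤ 24 s ‖u‖²` on the cone; this is the source of `s⁻²` in the exponent. -/

/-- The quadratic loss `½ vᵀ H v - ξᵀ v`. -/
noncomputable def quadLoss {p : ℕ} (H : Matrix (Fin p) (Fin p) ℝ) (ξ v : Fin p → ℝ) : ℝ :=
  1 / 2 * (v ⬝ᵥ H *ᵥ v) - ξ ⬝ᵥ v

section Deterministic

variable {p : ℕ} {H : Matrix (Fin p) (Fin p) ℝ} {ξ : Fin p → ℝ}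

lemma dotProduct_mulVec_symm (hH : Hᵀ = H) (u v : Fin p → ℝ) :
    u ⬝ᵥ H *ᵥ v = v ⬝ᵥ H *ᵥ u := by
  rw [Matrix.dotProduct_mulVec, ← Matrix.mulVec_transpose, hH, dotProduct_comm]

lemma quadLoss_add_smul (hH : Hᵀ = H) (b u : Fin p → ℝ) (t : ℝ) :
    quadLoss H ξ (b + t • u) =
      quadLoss H ξ b + t * ((H *ᵥ b - ξ) ⬝ᵥ u) + t ^ 2 / 2 * (u ⬝ᵥ H *ᵥ u) := by
  have h := dotProduct_mulVec_symm hH b u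
  have h' : H *ᵥ b ⬝ᵥ u = u ⬝ᵥ H *ᵥ b := dotProduct_comm _ _
  simp only [quadLoss, Matrix.mulVec_add, Matrix.mulVec_smul, dotProduct_add, add_dotProduct,
    dotProduct_smul, smul_dotProduct, sub_dotProduct, smul_eq_mul, h, h']
  ring

/-- This is the limit `t → 0⁺`, used to discard second-order terms in first-order optimality
conditions. -/
lemma le_of_forall_sub_mul_le {x y z : ℝ} (h : ∀ t : ℝ, 0 < t → t ≤ 1 → x - t * y ≤ z) :
    x ≤ z := by
  by_contra! hxz
  rcases le_or_gt y 0 with hy | hy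
  · have := h 1 one_pos le_rfl
    linarith
  · have ht : 0 < min 1 ((x - z) / (2 * y)) := by
      have : 0 < (x - z) / (2 * y) := div_pos (by linarith) (by linarith)
      positivity
    have h1 := h _ ht (min_le_left _ _)
    have h2 : min 1 ((x - z) / (2 * y)) * y ≤ (x - z) / (2 * y) * y :=
      mul_le_mul_of_nonneg_right (min_le_right _ _) hy.le
    have h3 : (x - z) / (2 * y) * y = (x - z) / 2 := by field_simp
    linarith

/-- The variational inequality satisfied by a minimizer of a penalized quadratic loss. -/
lemma variational_inequality (hH : Hᵀ = H) {lam : ℝ} (hlam : 0 ≤ lam) {v b : Fin p → ℝ}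
    (hv : ∀ i, 0 ≤ v i)
    (hmin : ∀ u : Fin p → ℝ, quadLoss H ξ b + lam * ∑ i, v i * |b i| ≤
      quadLoss H ξ u + lam * ∑ i, v i * |u i|) (c : Fin p → ℝ) :
    (H *ᵥ b - ξ) ⬝ᵥ (b - c) ≤ lam * ∑ i, v i * (|c i| - |b i|) := by
  -- Compare `b` with the point `b + t(c - b)`: the penalty is convex along this segment, so after
  -- division by `t` only a term of order `t` remains to be dropped.
  refine le_of_forall_sub_mul_le (y := 1 / 2 * ((c - b) ⬝ᵥ H *ᵥ (c - b))) fun t ht ht1 => ?_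
  have h := hmin (b + t • (c - b))
  rw [quadLoss_add_smul hH] at h
  have hpen : ∑ i, v i * |(b + t • (c - b)) i| ≤
      ∑ i, v i * |b i| + t * ∑ i, v i * (|c i| - |b i|) := by
    rw [Finset.mul_sum, ← Finset.sum_add_distrib]
    refine Finset.sum_le_sum fun i _ => ?_
    have hconv : |(b + t • (c - b)) i| ≤ (1 - t) * |b i| + t * |c i| := by
      have : (b + t • (c - b)) i = (1 - t) * b i + t * c i := by
        simp only [Pi.add_apply, Pi.smul_apply, Pi.sub_apply, smul_eq_mul]; ring
      rw [this]
      refine (abs_add_le _ _).trans (le_of_eq ?_)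
      rw [abs_mul, abs_mul, abs_of_nonneg (by linarith : 0 ≤ 1 - t), abs_of_pos ht]
    have := mul_le_mul_of_nonneg_left hconv (hv i)
    linarith
  have hpen' := mul_le_mul_of_nonneg_left hpen hlam
  have hneg : (H *ᵥ b - ξ) ⬝ᵥ (b - c) = -((H *ᵥ b - ξ) ⬝ᵥ (c - b)) := by
    rw [← dotProduct_neg, neg_sub]
  rw [hneg]
  have : 0 ≤ t * (lam * ∑ i, v i * (|c i| - |b i|) + (H *ᵥ b - ξ) ⬝ᵥ (c - b) +
      t * (1 / 2 * ((c - b) ⬝ᵥ H *ᵥ (c - b)))) := by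
    linarith
  have := nonneg_of_mul_nonneg_right this ht
  linarith

/-- The gradient of the loss vanishes on `S` at a minimizer among the vectors supported in `S`. -/
lemma gradient_eq_zero_of_minimizer (hH : Hᵀ = H) {S : Finset (Fin p)} {c : Fin p → ℝ}
    (hc : supp c ⊆ S) (hmin : ∀ v, supp v ⊆ S → quadLoss H ξ c ≤ quadLoss H ξ v)
    {i : Fin p} (hi : i ∈ S) : (ξ - H *ᵥ c) i = 0 := by
  -- Moving along the coordinate `i ∈ S` stays admissible for both signs of `t`, so the linear term
  -- must vanish.
  have key : ∀ t : ℝ, 0 ≤ t * (H *ᵥ c - ξ) i + t ^ 2 / 2 * H i i := by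
    intro t
    have h := hmin (c + t • Pi.single i 1) (by
      intro j hj
      by_contra hjS
      have hcj : c j = 0 := by
        by_contra h0
        exact hjS (hc (by simp [supp, h0]))
      have hji : j ≠ i := fun h => hjS (h ▸ hi)
      simp [supp, hcj, hji] at hj)
    rw [quadLoss_add_smul hH] at h
    simp only [dotProduct_single, mul_one, Matrix.mulVec_single, MulOpposite.op_one, one_smul,
      single_dotProduct, one_mul, Matrix.col_apply] at h
    linarith
  have h1 : (H *ᵥ c - ξ) i ≤ 0 := by
    refine le_of_forall_sub_mul_le (y := H i i / 2) fun t ht _ => ?_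
    have : 0 ≤ t * (-(H *ᵥ c - ξ) i + t * (H i i / 2)) := by
      have := key (-t); linarith
    have := nonneg_of_mul_nonneg_right this ht
    linarith
  have h2 : -(H *ᵥ c - ξ) i ≤ 0 := by
    refine le_of_forall_sub_mul_le (y := H i i / 2) fun t ht _ => ?_
    have : 0 ≤ t * ((H *ᵥ c - ξ) i + t * (H i i / 2)) := by
      have := key t; linarith
    have := nonneg_of_mul_nonneg_right this ht
    linarith
  simp only [Pi.sub_apply] at *
  linarith

/-- One stage of the relaxation: the error with respect to a vector `c` supported in `S`, whose
residual vanishes on `S` and is at most `lam / 6` elsewhere, is controlled by the weights. -/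
lemma stage_error_le (hH : Hᵀ = H) {lam κ : ℝ} (hlam : 0 < lam) {v b c : Fin p → ℝ}
    {S S' : Finset (Fin p)} (hpsd : ∀ u, 0 ≤ u ⬝ᵥ H *ᵥ u) (hRE : REC H S κ) (hSS' : S ⊆ S')
    (hcard : (S'.card : ℝ) ≤ 1.5 * (S.card : ℝ)) (hv : ∀ i, v i ∈ Set.Icc (0 : ℝ) 1)
    (hv' : ∀ i, i ∉ S' → 1 / 2 ≤ v i)
    (hmin : ∀ u : Fin p → ℝ, quadLoss H ξ b + lam * ∑ i, v i * |b i| ≤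
      quadLoss H ξ u + lam * ∑ i, v i * |u i|)
    (hc : ∀ i, i ∉ S → c i = 0) (hr : ∀ i ∈ S, (ξ - H *ᵥ c) i = 0)
    (hr' : ∀ i, |(ξ - H *ᵥ c) i| ≤ lam / 6) :
    κ ^ 2 * ∑ i, (b i - c i) ^ 2 ≤
      lam ^ 2 * (((S.filter fun i => v i ≠ 0).card : ℝ) + ((S' \ S).card : ℝ)) := by
  obtain ⟨hκ, hRE⟩ := hRE
  set d : Fin p → ℝ := b - c with hd
  have hdi : ∀ i, b i - c i = d i := fun i => rfl
  have hvar := variational_inequality hH hlam.le (fun i => (hv i).1) hmin c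
  set r := ξ - H *ᵥ c with hrdef
  have hquad : d ⬝ᵥ H *ᵥ d = (H *ᵥ b - ξ) ⬝ᵥ d + r ⬝ᵥ d := by
    rw [← add_dotProduct, dotProduct_comm]
    congr 1
    rw [hd, Matrix.mulVec_sub, hrdef]
    abel
  -- Coefficients of `|d i|` after adding penalty and residual: on S the residual vanishes; on `S' \
  -- S` only the residual's `1/6` is kept; off `S'` the balance is at most `1/6 - 1/2 = -1/3`. The
  -- last value yields the factor `3` of the cone.
  set u : Fin p → ℝ := fun i => if i ∈ S then v i else if i ∈ S' then 1 / 6 else -(1 / 3) with hu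
  have hub : d ⬝ᵥ H *ᵥ d ≤ lam * ∑ i, u i * |d i| := by
    rw [hquad]
    refine (add_le_add_left hvar _).trans ?_
    rw [dotProduct, Finset.mul_sum, Finset.mul_sum, ← Finset.sum_add_distrib]
    refine Finset.sum_le_sum fun i _ => ?_
    by_cases hiS : i ∈ S
    · rw [hr i hiS]
      have : |c i| - |b i| ≤ |d i| := by
        have := abs_sub_abs_le_abs_sub (c i) (b i)
        rwa [abs_sub_comm] at this
      have := mul_le_mul_of_nonneg_left (mul_le_mul_of_nonneg_left this (hv i).1) hlam.le
      simp only [hu, hiS, if_true]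
      linarith
    · have hbi : b i = d i := by simp [hd, hc i hiS]
      have h1 : r i * d i ≤ lam / 6 * |d i| := by
        refine (le_abs_self _).trans ?_
        rw [abs_mul]
        exact mul_le_mul_of_nonneg_right (hr' i) (abs_nonneg _)
      rw [hc i hiS, hbi, abs_zero]
      by_cases hiS' : i ∈ S'
      · simp only [hu, hiS, hiS', if_true, if_false]
        have : 0 ≤ lam * (v i * |d i|) :=
          mul_nonneg hlam.le (mul_nonneg (hv i).1 (abs_nonneg _))
        linarith
      · simp only [hu, hiS, hiS', if_false]
        have : lam * (1 / 2 * |d i|) ≤ lam * (v i * |d i|) :=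
          mul_le_mul_of_nonneg_left
            (mul_le_mul_of_nonneg_right (hv' i hiS') (abs_nonneg _)) hlam.le
        linarith
  have hcone : d ∈ coneSet S := by
    refine ⟨S', hSS', hcard, ?_⟩
    have h0 : 0 ≤ d ⬝ᵥ H *ᵥ d := hpsd d
    have h1 : ∑ i, u i * |d i| ≤ ∑ i ∈ S', |d i| - 1 / 3 * ∑ i ∈ S'ᶜ, |d i| := by
      rw [← Finset.sum_add_sum_compl S', Finset.mul_sum, sub_eq_add_neg, ← Finset.sum_neg_distrib]
      refine add_le_add (Finset.sum_le_sum fun i hi => ?_) (Finset.sum_le_sum fun i hi => ?_)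
      · have : u i ≤ 1 := by
          simp only [hu, hi, if_true]
          split_ifs
          exacts [(hv i).2, by norm_num]
        simpa using mul_le_mul_of_nonneg_right this (abs_nonneg (d i))
      · have hiS' : i ∉ S' := Finset.mem_compl.1 hi
        have hiS : i ∉ S := fun h => hiS' (hSS' h)
        simp only [hu, hiS, hiS', if_false]
        linarith
    have h2 : 0 ≤ ∑ i, u i * |d i| := nonneg_of_mul_nonneg_right (h0.trans hub) hlam
    linarith
  have hRE' := hRE d hcone
  -- Only these coordinates can have a positive coefficient; they index the wrong weights.
  set W := (S.filter fun i => v i ≠ 0) ∪ (S' \ S) with hW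
  have hWcard : (W.card : ℝ) ≤
      ((S.filter fun i => v i ≠ 0).card : ℝ) + ((S' \ S).card : ℝ) := by
    exact_mod_cast Finset.card_union_le _ _
  have hsumW : ∑ i, u i * |d i| ≤ ∑ i ∈ W, |d i| := by
    rw [← Finset.sum_add_sum_compl W]
    have h1 : ∑ i ∈ W, u i * |d i| ≤ ∑ i ∈ W, |d i| := by
      refine Finset.sum_le_sum fun i _ => ?_
      have : u i ≤ 1 := by
        simp only [hu]
        split_ifs
        exacts [(hv i).2, by norm_num, by norm_num]
      simpa using mul_le_mul_of_nonneg_right this (abs_nonneg (d i))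
    have h2 : ∑ i ∈ Wᶜ, u i * |d i| ≤ 0 := by
      refine Finset.sum_nonpos fun i hi => ?_
      have : u i ≤ 0 := by
        simp only [hW, Finset.mem_compl, Finset.mem_union, Finset.mem_filter, Finset.mem_sdiff,
          not_or, not_and, not_not] at hi
        simp only [hu]
        split_ifs with h3 h4
        exacts [(hi.1 h3).le, absurd (hi.2 h4) h3, by norm_num]
      exact mul_nonpos_of_nonpos_of_nonneg this (abs_nonneg _)
    linarith
  simp only [hdi]
  set D := ∑ i, d i ^ 2 with hD
  have hD0 : 0 ≤ D := Finset.sum_nonneg fun i _ => sq_nonneg _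
  have hCS : (∑ i ∈ W, |d i|) ^ 2 ≤ W.card * D := by
    refine sq_sum_le_card_mul_sum_sq.trans (mul_le_mul_of_nonneg_left ?_ (Nat.cast_nonneg _))
    simp only [sq_abs]
    exact Finset.sum_le_sum_of_subset_of_nonneg (Finset.subset_univ _) fun i _ _ => sq_nonneg _
  have hκD : κ * D ≤ lam * ∑ i ∈ W, |d i| :=
    hRE'.trans (hub.trans (mul_le_mul_of_nonneg_left hsumW hlam.le))
  have hsq : (κ * D) ^ 2 ≤ lam ^ 2 * (W.card * D) := by
    refine (pow_le_pow_left₀ (by positivity) hκD 2).trans ?_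
    rw [mul_pow]
    exact mul_le_mul_of_nonneg_left hCS (sq_nonneg _)
  refine le_trans ?_ (mul_le_mul_of_nonneg_left hWcard (sq_nonneg lam))
  rcases hD0.eq_or_lt with h | h
  · rw [← h, mul_zero]; positivity
  · refine le_of_mul_le_mul_right ?_ h
    linarith

/-! ### Weight updates and thresholds -/

/-- The second factor is the mean slope of φ between `t` and `s`. Comparing a minimizer with `1/2`
or `1` and cancelling `s - t` turns optimality into a threshold for `ρ * x`. The slope is `1` when
`s + t = 1` and `2a/(a+1)` when `s + t = 2`. -/
lemma phi_sub_phi (a s t : ℝ) :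
    phi a s - phi a t = (s - t) * ((a - 1) / (a + 1) * (s + t) + 2 / (a + 1)) := by
  simp only [phi]; ring

/-- A weight above `1/2` comes from a large coordinate. -/
lemma one_lt_of_half_lt_weight {a ρ x w : ℝ} (ha : 1 < a) (hw : 1 / 2 < w)
    (hmin : ∀ t ∈ Set.Icc (0 : ℝ) 1, phi a w - ρ * w * x ≤ phi a t - ρ * t * x) :
    1 < ρ * x := by
  have h := hmin (1 / 2) ⟨by norm_num, by norm_num⟩
  have h1 := phi_sub_phi a w (1 / 2)
  have h2 : 0 ≤ (w - 1 / 2) *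
      (ρ * x - ((a - 1) / (a + 1) * (w + 1 / 2) + 2 / (a + 1))) := by linarith
  have h3 := nonneg_of_mul_nonneg_right h2 (by linarith)
  have h4 : 0 < (a - 1) / (a + 1) := div_pos (by linarith) (by linarith)
  have h5 : (a - 1) / (a + 1) + 2 / (a + 1) = 1 := by
    rw [← add_div, div_eq_one_iff_eq (by linarith)]; ring
  nlinarith

/-- A weight below `1` comes from a small coordinate. -/
lemma lt_of_weight_lt_one {a ρ x w : ℝ} (ha : 1 < a) (hw : w < 1)
    (hmin : ∀ t ∈ Set.Icc (0 : ℝ) 1, phi a w - ρ * w * x ≤ phi a t - ρ * t * x) :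
    ρ * x < 2 * a / (a + 1) := by
  have h := hmin 1 ⟨by norm_num, le_rfl⟩
  have h1 := phi_sub_phi a 1 w
  have h2 : 0 ≤ (1 - w) *
      (((a - 1) / (a + 1) * (1 + w) + 2 / (a + 1)) - ρ * x) := by linarith
  have h3 := nonneg_of_mul_nonneg_right h2 (by linarith)
  have h4 : 0 < (a - 1) / (a + 1) := div_pos (by linarith) (by linarith)
  have h5 : 2 * a / (a + 1) = 2 * ((a - 1) / (a + 1)) + 2 / (a + 1) := by
    field_simp; ring
  nlinarith

/-- The coordinates where the next weights are wrong have a large error. -/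
lemma card_weight_errors_le {a ρ g : ℝ} (ha : 1 < a) (hρ : 0 < ρ) {b c w : Fin p → ℝ}
    {S : Finset (Fin p)} (hc : ∀ i, i ∉ S → c i = 0)
    (hbig : ∀ i ∈ S, 2 * a / (a + 1) + g ≤ ρ * |c i|) (hg : 0 ≤ g) (hg' : 1 ≤ 2 * g ^ 2)
    (hmin : ∀ i, ∀ t ∈ Set.Icc (0 : ℝ) 1,
      phi a (w i) - ρ * w i * |b i| ≤ phi a t - ρ * t * |b i|) :
    ((S.filter fun i => w i < 1).card : ℝ) +
      (((Finset.univ.filter fun i => 1 / 2 < w i) \ S).card : ℝ) ≤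
        2 * ρ ^ 2 * ∑ i, (b i - c i) ^ 2 := by
  have hdisj : Disjoint (S.filter fun i => w i < 1)
      ((Finset.univ.filter fun i => 1 / 2 < w i) \ S) :=
    Finset.disjoint_of_subset_left (Finset.filter_subset _ _) Finset.disjoint_sdiff
  rw [← Nat.cast_add, ← Finset.card_union_of_disjoint hdisj, Finset.card_eq_sum_ones,
    Nat.cast_sum, Finset.mul_sum]
  push_cast
  -- On S, the oracle coordinate exceeds the threshold by the margin `g`, while `b i` lies below it.
  -- Off S, `c i = 0` and `ρ|b i| > 1`. Either way `ρ²(b i - c i)² ≥ 1/2`.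
  have hone : ∀ i ∈ (S.filter fun i => w i < 1) ∪
      ((Finset.univ.filter fun i => 1 / 2 < w i) \ S), 1 ≤ 2 * ρ ^ 2 * (b i - c i) ^ 2 := by
    intro i hi
    simp only [Finset.mem_union, Finset.mem_filter, Finset.mem_sdiff, Finset.mem_univ,
      true_and] at hi
    rw [mul_assoc, ← mul_pow, ← sq_abs, abs_mul, abs_of_pos hρ]
    rcases hi with ⟨hiS, hw⟩ | ⟨hw, hiS⟩
    · have h1 := lt_of_weight_lt_one ha hw (hmin i)
      have h2 := hbig i hiS
      have h3 : |c i| - |b i| ≤ |b i - c i| := by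
        rw [abs_sub_comm]; exact abs_sub_abs_le_abs_sub _ _
      have h4 := mul_le_mul_of_nonneg_left h3 hρ.le
      have h5 : g ≤ ρ * |b i - c i| := by linarith
      have := pow_le_pow_left₀ hg h5 2
      linarith
    · have h1 := one_lt_of_half_lt_weight ha hw (hmin i)
      rw [hc i hiS, sub_zero]
      nlinarith
  exact (Finset.sum_le_sum hone).trans (Finset.sum_le_sum_of_subset_of_nonneg
    (Finset.subset_univ _) fun i _ _ => by positivity)

end Deterministic

/-! ### Convergence to the oracle estimator -/

lemma sqrt_three_bounds : (1.73 : ℝ) < √3 ∧ √3 < 1.7321 := by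
  constructor
  · rw [Real.lt_sqrt] <;> norm_num
  · rw [Real.sqrt_lt'] <;> norm_num

/-- After `kHat` stages the geometric error bound is below `1`. -/
lemma pow_kHat_mul_lt_one {s : ℕ} {κ lam ρ : ℝ} (hs : 1 ≤ s) (hκ : 0 < κ) (hlam : 0 < lam)
    (hρ : 1 ≤ ρ) (hρκ : ρ ^ 2 * lam * (18 * √3) ≤ 5 * κ) :
    (8 * ρ ^ 2 * (lam / κ) ^ 2) ^ kHat s κ lam ρ * (s : ℝ) < 1 := by
  obtain ⟨h3, h3'⟩ := sqrt_three_bounds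
  have h33 : √3 ^ 2 = (3 : ℝ) := Real.sq_sqrt (by norm_num)
  have hρ0 : 0 < ρ := by linarith
  have hnum : 0 < (9 * √3 - 4) * 5 * κ * lam⁻¹ := by
    have : 0 < 9 * √3 - 4 := by linarith
    positivity
  have hden : 0 < 147 * √3 * ρ ^ 2 := by positivity
  set R := (9 * √3 - 4) * 5 * κ * lam⁻¹ / (147 * √3 * ρ ^ 2) with hR
  -- This makes the denominator in `kHat` positive, so the iteration count does yield `s ≤ R^(2k)`.
  have hR1 : 1 < R := by
    rw [hR, one_lt_div hden, ← div_eq_mul_inv, lt_div_iff₀ hlam]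
    nlinarith
  have hR0 : 0 < R := by linarith
  have hlogR : 0 < Real.log R := Real.log_pos hR1
  set k := kHat s κ lam ρ with hk
  have hk1 : 1 ≤ k := le_max_left _ _
  have hk2 : 0.5 * Real.log s / Real.log R ≤ k := by
    rw [hR, Real.log_div hnum.ne' hden.ne']
    exact (Nat.le_ceil _).trans (by exact_mod_cast le_max_right _ _)
  have hs0 : (0 : ℝ) < s := by exact_mod_cast hs
  have hsR : (s : ℝ) ≤ (R ^ 2) ^ k := by
    rw [← Real.log_le_log_iff hs0 (by positivity), Real.log_pow, Real.log_pow]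
    rw [div_le_iff₀ hlogR] at hk2
    push_cast
    linarith
  -- κ and λ cancel, leaving `200(259 - 72√3) / (64827 ρ²)`, which is below `1` because `ρ ≥ 1`.
  have hqR : 8 * ρ ^ 2 * (lam / κ) ^ 2 * R ^ 2 < 1 := by
    have : 8 * ρ ^ 2 * (lam / κ) ^ 2 * R ^ 2 =
        200 * (9 * √3 - 4) ^ 2 / (21609 * √3 ^ 2 * ρ ^ 2) := by
      rw [hR]; field_simp; ring
    rw [this, h33, div_lt_one (by positivity)]
    have : (9 * √3 - 4) ^ 2 = 259 - 72 * √3 := by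
      ring_nf; rw [h33]; ring
    rw [this]
    nlinarith
  calc (8 * ρ ^ 2 * (lam / κ) ^ 2) ^ k * (s : ℝ)
      ≤ (8 * ρ ^ 2 * (lam / κ) ^ 2) ^ k * (R ^ 2) ^ k :=
        mul_le_mul_of_nonneg_left hsR (by positivity)
    _ = (8 * ρ ^ 2 * (lam / κ) ^ 2 * R ^ 2) ^ k := by rw [mul_pow _ (R ^ 2)]
    _ < 1 := pow_lt_one₀ (by positivity) hqR (by omega)

/-- Monotonicity up to stage 3 and constancy afterwards let the hypotheses on `ρ 1` and `ρ 3`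
control every stage. -/
lemma IsRun.rho_bounds {n p : ℕ} {Zt : Matrix (Fin p) (Fin p) ℝ} {yt : Fin p → ℝ} {lam a : ℝ}
    {b w : ℕ → Fin p → ℝ} {ρ : ℕ → ℝ} (h : IsRun n Zt yt lam a b w ρ) :
    1 ≤ ρ 1 ∧ ∀ k, 1 ≤ k → ρ 1 ≤ ρ k ∧ ρ k ≤ ρ 3 := by
  have h01 := h.rho_step 1 le_rfl (by norm_num)
  have h12 := h.rho_step 2 (by norm_num) (by norm_num)
  have h23 := h.rho_step 3 (by norm_num) le_rfl
  simp only [Nat.sub_self, h.rho_zero, Nat.reduceSub] at h01 h12 h23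
  have hconst : ∀ j, ρ (3 + j) = ρ 3 := by
    intro j
    induction j with
    | zero => rfl
    | succ j ih => rw [← ih, h.rho_const (3 + (j + 1)) (by omega)]; rfl
  refine ⟨h01, fun k hk => ?_⟩
  rcases Nat.lt_or_ge k 3 with hk3 | hk3
  · interval_cases k
    exacts [⟨le_rfl, h12.trans h23⟩, ⟨h12, h23⟩]
  · obtain ⟨j, rfl⟩ := Nat.exists_eq_add_of_le hk3
    rw [hconst]
    exact ⟨h12.trans h23, le_rfl⟩

lemma minAbs_le {p : ℕ} (b : Fin p → ℝ) {i : Fin p} (hi : i ∈ supp b) : minAbs b ≤ |b i| :=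
  ciInf_le (f := fun i : supp b => |b i|) (Set.finite_range _).bddBelow ⟨i, hi⟩

lemma minAbs_pos {p : ℕ} {b : Fin p → ℝ} (hb : (supp b).Nonempty) : 0 < minAbs b := by
  have : Nonempty (supp b) := hb.to_subtype
  obtain ⟨i, hi⟩ := exists_eq_ciInf_of_finite (f := fun i : supp b => |b i|)
  rw [minAbs, ← hi]
  have := i.2
  simp only [supp, Finset.mem_filter] at this
  exact abs_pos.2 this.2

/-- The multi-stage convex relaxation reaches the oracle estimator after `kHat` stages. -/
theorem IsRun.eq_oracle {n p : ℕ} {Zt H : Matrix (Fin p) (Fin p) ℝ} {yt ξ bstar c : Fin p → ℝ}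
    {lam a κ K K₀ : ℝ} {b w : ℕ → Fin p → ℝ} {ρ : ℕ → ℝ} (h : IsRun n Zt yt lam a b w ρ)
    (hloss : ∀ v, lsLoss n Zt yt v = quadLoss H ξ v + K₀) (hH : Hᵀ = H)
    (hpsd : ∀ u, 0 ≤ u ⬝ᵥ H *ᵥ u) (hb : (supp bstar).Nonempty)
    (hRE : REC H (supp bstar) (κ / 2)) (hc : IsOracleLS n Zt yt (supp bstar) c)
    (hr : ∀ i, |(ξ - H *ᵥ c) i| ≤ lam / 6) (hK : ∀ i ∈ supp bstar, |c i - bstar i| ≤ K)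
    (hρ1 : max (4 * a / ((a + 1) * minAbs bstar)) (5 * κ * K / (8 * lam)) < ρ 1)
    (hρ3 : ρ 3 ≤ √(5 * κ / (18 * √3 * lam))) {k : ℕ}
    (hk : kHat (supp bstar).card κ lam (ρ 3) < k) :
    b k = c ∧ ∀ i, SignType.sign (b k i) = SignType.sign (bstar i) := by
  obtain ⟨h3, h3'⟩ := sqrt_three_bounds
  have hlam := h.lam_pos
  have ha := h.a_gt
  have hκ : 0 < κ := by have := hRE.1; linarith
  obtain ⟨hρ11, hρk⟩ := h.rho_bounds
  have hρ31 : 1 ≤ ρ 3 := hρ11.trans (hρk 3 (by norm_num)).1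
  set S := supp bstar with hS
  have hcS : ∀ i, i ∉ S → c i = 0 := fun i hi => by
    by_contra h0
    exact hi (hc.supp_subset (by simp [supp, h0]))
  have hrS : ∀ i ∈ S, (ξ - H *ᵥ c) i = 0 := fun i hi =>
    gradient_eq_zero_of_minimizer hH hc.supp_subset (fun v hv => by
      have := hc.le v hv
      rw [hloss, hloss] at this
      linarith) hi
  have hρκ : ρ 3 ^ 2 * lam * (18 * √3) ≤ 5 * κ := by
    have := (Real.le_sqrt (by linarith) (by positivity)).1 hρ3
    rw [le_div_iff₀ (by positivity)] at this
    linarith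
  obtain ⟨hρa, hρb⟩ := max_lt_iff.1 hρ1
  -- The two bounds on ρ combine to `5κ K ρ₃ ≤ 8λρ₃²` and `λρ₃² ≤ 5κ/(18√3)`, and `8/(18 · 1.73) <
  -- 0.26`.
  have hKρ : K * ρ 3 ≤ 0.26 := by
    rw [div_lt_iff₀ (by positivity)] at hρb
    have h1 : 5 * κ * (K * ρ 3) ≤ ρ 1 * (8 * lam) * ρ 3 := by
      rw [← mul_assoc]; exact mul_le_mul_of_nonneg_right hρb.le (by linarith)
    have h2 : ρ 1 * (8 * lam) * ρ 3 ≤ ρ 3 * (8 * lam) * ρ 3 := by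
      have := (hρk 3 (by norm_num)).1
      gcongr
    have h4 : ρ 3 ^ 2 * lam * (18 * 1.73) ≤ 5 * κ := by
      refine le_trans ?_ hρκ
      gcongr
    have : κ * (K * ρ 3) ≤ κ * 0.26 := by linarith
    exact le_of_mul_le_mul_left this hκ
  have haa : 1 < 2 * a / (a + 1) := by
    rw [one_lt_div (by linarith)]; linarith
  have hmin0 := minAbs_pos hb
  have hstar : ∀ i ∈ S, ∀ r, ρ 1 ≤ r → 2 * (2 * a / (a + 1)) ≤ r * |bstar i| := by
    intro i hi r hr1
    have h1 : 4 * a / (a + 1) < ρ 1 * minAbs bstar := by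
      rw [← div_div, div_lt_iff₀ hmin0] at hρa
      exact hρa
    have h2 : ρ 1 * minAbs bstar ≤ r * |bstar i| :=
      mul_le_mul hr1 (minAbs_le _ hi) hmin0.le (by linarith)
    have : 2 * (2 * a / (a + 1)) = 4 * a / (a + 1) := by ring
    linarith
  have hK0 : 0 ≤ K := by
    obtain ⟨i, hi⟩ := hb
    exact (abs_nonneg _).trans (hK i hi)
  have hKr : ∀ k, 1 ≤ k → K * ρ k ≤ 0.26 := fun k hk =>
    (mul_le_mul_of_nonneg_left (hρk k hk).2 hK0).trans hKρ
  -- The number of wrong weights after stage `k`, the quantity that contracts.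
  set N : ℕ → ℝ := fun k => ((S.filter fun i => w k i < 1).card : ℝ) +
    (((Finset.univ.filter fun i => 1 / 2 < w k i) \ S).card : ℝ) with hN
  have hN0 : ∀ k, 0 ≤ N k := fun k => by positivity
  -- The contraction factor: `4(λ/κ)²` from a stage with constant `κ/2`, times `2ρ₃²` from the
  -- weight update.
  set q := 8 * ρ 3 ^ 2 * (lam / κ) ^ 2 with hq
  have hq0 : 0 ≤ q := by positivity
  have hq4 : q ≤ 1 / 2 := by
    have h1 : ρ 3 ^ 2 * (lam / κ) ≤ 0.17 := by
      rw [mul_div_assoc', div_le_iff₀ hκ]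
      have : ρ 3 ^ 2 * lam * (18 * 1.73) ≤ 5 * κ := by
        refine le_trans ?_ hρκ
        gcongr
      linarith
    have h2 : lam / κ ≤ 0.17 := by
      refine le_trans ?_ h1
      have : 1 ≤ ρ 3 ^ 2 := by nlinarith
      exact le_mul_of_one_le_left (by positivity) this
    have h5 : ρ 3 ^ 2 * (lam / κ) * (lam / κ) ≤ 0.17 * 0.17 :=
      mul_le_mul h1 h2 (by positivity) (by norm_num)
    rw [hq]
    linarith
  -- the error of a stage, in terms of the preceding weights
  have herr : ∀ k, (((Finset.univ.filter fun i => 1 / 2 < w k i) \ S).card : ℝ) ≤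
      0.5 * (S.card : ℝ) → ∑ i, (b (k + 1) i - c i) ^ 2 ≤ 4 * (lam / κ) ^ 2 * N k := by
    intro k hcard
    have hw01 : ∀ i, w k i ∈ Set.Icc (0 : ℝ) 1 := by
      intro i
      rcases Nat.eq_zero_or_pos k with rfl | hk
      · exact ⟨(h.w_zero i).1, (h.w_zero i).2.trans (by norm_num)⟩
      · exact h.w_mem k hk i
    -- At most `s/2` false positives keep `|S'| ≤ 1.5 s`, as the cone requires.
    set S' := S ∪ ((Finset.univ.filter fun i => 1 / 2 < w k i) \ S) with hS'
    have hSS' : S' \ S = (Finset.univ.filter fun i => 1 / 2 < w k i) \ S := by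
      rw [hS', Finset.union_sdiff_left, Finset.sdiff_idem]
    have hmain := stage_error_le (ξ := ξ) hH hlam (v := fun i => 1 - w k i) (b := b (k + 1))
      (c := c) hpsd hRE (S' := S') Finset.subset_union_left (by
        rw [hS', Finset.card_union_of_disjoint Finset.disjoint_sdiff]
        push_cast
        linarith)
      (fun i => ⟨by have := (hw01 i).2; linarith, by have := (hw01 i).1; linarith⟩)
      (fun i hi => by
        simp only [hS', Finset.mem_union, Finset.mem_sdiff, Finset.mem_filter, Finset.mem_univ,
          true_and, not_or, not_and, not_not] at hi
        by_contra! hlt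
        exact hi.1 (hi.2 (by linarith)))
      (fun u => by
        have := h.beta_step (k + 1) (by omega) u
        rw [hloss, hloss] at this
        simp only [Nat.add_sub_cancel] at this
        linarith) hcS hrS hr
    have hfilter : S.filter (fun i => 1 - w k i ≠ 0) = S.filter (fun i => w k i < 1) := by
      refine Finset.filter_congr fun i _ => ?_
      rw [sub_ne_zero, ne_comm, lt_iff_le_and_ne]
      exact ⟨fun hne => ⟨(hw01 i).2, hne⟩, fun hlt => hlt.2⟩
    rw [hfilter, hSS'] at hmain
    have hκ2 : (κ / 2) ^ 2 * ∑ i, (b (k + 1) i - c i) ^ 2 ≤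
        (κ / 2) ^ 2 * (4 * (lam / κ) ^ 2 * N k) := by
      refine hmain.trans (le_of_eq ?_)
      simp only [hN]
      field_simp
      ring
    exact le_of_mul_le_mul_left hκ2 (by positivity)
  have hstep : ∀ k, (((Finset.univ.filter fun i => 1 / 2 < w k i) \ S).card : ℝ) ≤
      0.5 * (S.card : ℝ) → N (k + 1) ≤ q * N k := by
    intro k hcard
    have hk1 : 1 ≤ k + 1 := by omega
    have hρ0 : 0 < ρ (k + 1) := by have := (hρk _ hk1).1; linarith
    -- The margin is `0.74 = 1 - 0.26`: one threshold `2a/(a+1) > 1` is left over from the bound on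
    -- `|bstar i|`, and passing to the oracle costs at most `0.26`. Moreover `2 · 0.74² ≥ 1`.
    have h1 := card_weight_errors_le (g := 0.74) ha hρ0 hcS (fun i hi => by
      have h1 := hstar i hi _ (hρk _ hk1).1
      have h2 : |bstar i| ≤ |c i| + K := by
        have h3 := hK i hi
        have h4 := abs_sub_abs_le_abs_sub (bstar i) (c i)
        rw [abs_sub_comm] at h4
        linarith
      have h3 := mul_le_mul_of_nonneg_left h2 hρ0.le
      have h4 := hKr _ hk1
      linarith) (by norm_num) (by norm_num) (h.w_step (k + 1) hk1)
    have h2 := herr k hcard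
    have h4 : ρ (k + 1) ^ 2 ≤ ρ 3 ^ 2 := pow_le_pow_left₀ hρ0.le (hρk _ hk1).2 2
    calc N (k + 1) ≤ 2 * ρ (k + 1) ^ 2 * ∑ i, (b (k + 1) i - c i) ^ 2 := h1
      _ ≤ 2 * ρ 3 ^ 2 * (4 * (lam / κ) ^ 2 * N k) := by
          have := hN0 k
          gcongr
      _ = q * N k := by rw [hq]; ring
  have hs1 : 1 ≤ S.card := hb.card_pos
  -- The count and the false-positive bound must be carried together: `q ≤ 1/2` preserves the
  -- latter, which licenses the next stage.
  have hind : ∀ k, N k ≤ q ^ k * S.card ∧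
      (((Finset.univ.filter fun i => 1 / 2 < w k i) \ S).card : ℝ) ≤ 0.5 * (S.card : ℝ) := by
    intro k
    induction k with
    | zero =>
      have hempty : (Finset.univ.filter fun i => 1 / 2 < w 0 i) = ∅ :=
        Finset.filter_eq_empty_iff.2 fun i _ => not_lt.2 (h.w_zero i).2
      simp only [hN, hempty, Finset.empty_sdiff, Finset.card_empty, Nat.cast_zero, add_zero,
        pow_zero, one_mul]
      exact ⟨by exact_mod_cast Finset.card_filter_le _ _, by positivity⟩
    | succ k ih =>
      have h1 := hstep k ih.2
      have h2 : q * N k ≤ q ^ (k + 1) * S.card := by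
        rw [pow_succ', mul_assoc q]
        exact mul_le_mul_of_nonneg_left ih.1 hq0
      refine ⟨h1.trans h2, ?_⟩
      have h4 : q ^ (k + 1) ≤ 0.5 := by
        rw [pow_succ']
        have : q ^ k ≤ 1 := pow_le_one₀ hq0 (by linarith)
        have := mul_le_mul hq4 this (by positivity) (by norm_num)
        linarith
      have h5 : q ^ (k + 1) * S.card ≤ 0.5 * S.card :=
        mul_le_mul_of_nonneg_right h4 (Nat.cast_nonneg _)
      have h6 : (((Finset.univ.filter fun i => 1 / 2 < w (k + 1) i) \ S).card : ℝ) ≤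
          N (k + 1) := le_add_of_nonneg_left (Nat.cast_nonneg _)
      linarith
  obtain ⟨j, rfl⟩ : ∃ j, k = j + 1 := ⟨k - 1, by omega⟩
  have hNj : N j < 1 := by
    refine (hind j).1.trans_lt (lt_of_le_of_lt ?_
      (pow_kHat_mul_lt_one hs1 hκ hlam hρ31 hρκ))
    exact mul_le_mul_of_nonneg_right
      (pow_le_pow_of_le_one hq0 (by linarith) (by omega)) (Nat.cast_nonneg _)
  -- A natural number below `1` vanishes.
  have hNj0 : N j = 0 := by
    have : N j = (((S.filter fun i => w j i < 1).card +
      ((Finset.univ.filter fun i => 1 / 2 < w j i) \ S).card : ℕ) : ℝ) := by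
      simp only [hN, Nat.cast_add]
    rw [this] at hNj ⊢
    have : (S.filter fun i => w j i < 1).card +
      ((Finset.univ.filter fun i => 1 / 2 < w j i) \ S).card < 1 := by exact_mod_cast hNj
    exact_mod_cast Nat.lt_one_iff.1 this
  have hD := herr j (hind j).2
  rw [hNj0, mul_zero] at hD
  have hbc : b (j + 1) = c := by
    have h0 := (Finset.sum_eq_zero_iff_of_nonneg fun i _ => sq_nonneg _).1
      (le_antisymm hD (Finset.sum_nonneg fun i _ => sq_nonneg (b (j + 1) i - c i)))
    funext i
    exact sub_eq_zero.1 (pow_eq_zero_iff (two_ne_zero) |>.1 (h0 i (Finset.mem_univ i)))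
  refine ⟨hbc, fun i => ?_⟩
  rw [hbc]
  by_cases hi : i ∈ S
  · have h1 := hstar i hi _ le_rfl
    have h2 := hKr 1 le_rfl
    -- Otherwise `ρ 1 * |bstar i| ≤ 0.26`, against the lower bound `4a/(a+1)`; so the oracle error
    -- cannot change a sign.
    have h4 : K < |bstar i| := by
      by_contra! hle
      have := mul_le_mul_of_nonneg_left hle (by linarith : 0 ≤ ρ 1)
      linarith
    have h5 := (hK i hi).trans_lt h4
    rcases lt_trichotomy (bstar i) 0 with h6 | h6 | h6
    · rw [abs_of_neg h6] at h5
      have := (abs_lt.1 h5).2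
      rw [sign_neg h6, sign_neg (by linarith)]
    · rw [h6, abs_zero] at h4
      linarith
    · rw [abs_of_pos h6] at h5
      have := (abs_lt.1 h5).1
      rw [sign_pos h6, sign_pos (by linarith)]
  · have : bstar i = 0 := by simpa [hS, supp] using hi
    rw [this, hcS i hi]

/-! ### The calibrated matrix -/

section Calibration
variable {p : ℕ} {A : Matrix (Fin p) (Fin p) ℝ}

/-- In an eigenbasis the form is a weighted sum of squares, so pointwise inequalities between
functions on the spectrum become inequalities between quadratic forms. -/
lemma dotProduct_cfc_mulVec (hA : A.IsHermitian) (f : ℝ → ℝ) (u : Fin p → ℝ) :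
    u ⬝ᵥ cfc f A *ᵥ u = ∑ i, f (hA.eigenvalues i) *
      ((star (hA.eigenvectorUnitary : Matrix (Fin p) (Fin p) ℝ)) *ᵥ u) i ^ 2 := by
  rw [hA.cfc_eq, Matrix.IsHermitian.cfc, Unitary.conjStarAlgAut_apply, ← Matrix.mulVec_mulVec,
    ← Matrix.mulVec_mulVec, Matrix.dotProduct_mulVec, ← Matrix.mulVec_transpose]
  simp only [dotProduct, Matrix.mulVec_diagonal, Matrix.star_eq_conjTranspose,
    Matrix.conjTranspose_eq_transpose_of_trivial]
  refine Finset.sum_congr rfl fun i _ => ?_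
  simp
  ring

lemma cfc_transpose (f : ℝ → ℝ) : (cfc f A)ᵀ = cfc f A := by
  have := (cfc_predicate f A : IsSelfAdjoint (cfc f A))
  rwa [isSelfAdjoint_iff, Matrix.star_eq_conjTranspose,
    Matrix.conjTranspose_eq_transpose_of_trivial] at this

lemma dotProduct_cfc_mulVec_mono (hA : A.IsHermitian) {f g : ℝ → ℝ}
    (hfg : ∀ x ∈ spectrum ℝ A, f x ≤ g x) (u : Fin p → ℝ) :
    u ⬝ᵥ cfc f A *ᵥ u ≤ u ⬝ᵥ cfc g A *ᵥ u := by
  rw [dotProduct_cfc_mulVec hA, dotProduct_cfc_mulVec hA]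
  exact Finset.sum_le_sum fun i _ => mul_le_mul_of_nonneg_right
    (hfg _ (hA.eigenvalues_mem_spectrum_real i)) (sq_nonneg _)

lemma dotProduct_cfc_const_mulVec (hA : A.IsHermitian) (r : ℝ) (u : Fin p → ℝ) :
    u ⬝ᵥ cfc (fun _ : ℝ => r) A *ᵥ u = r * ∑ i, u i ^ 2 := by
  rw [cfc_const r A hA.isSelfAdjoint, Algebra.algebraMap_eq_smul_one, Matrix.smul_mulVec, Matrix.one_mulVec,
    dotProduct_smul, smul_eq_mul, dotProduct]
  simp only [sq]

/-- A lower bound of the quadratic form bounds the spectrum from below. -/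
lemma le_of_mem_spectrum (hA : A.IsHermitian) {r : ℝ}
    (h : ∀ u, r * ∑ i, u i ^ 2 ≤ u ⬝ᵥ A *ᵥ u) {x : ℝ} (hx : x ∈ spectrum ℝ A) : r ≤ x := by
  rw [hA.spectrum_real_eq_range_eigenvalues] at hx
  obtain ⟨i, rfl⟩ := hx
  have h1 := h (hA.eigenvectorBasis i)
  rw [hA.mulVec_eigenvectorBasis, dotProduct_smul, dotProduct] at h1
  have h2 : ∑ j, (hA.eigenvectorBasis i).ofLp j ^ 2 = 1 := by
    rw [← EuclideanSpace.real_norm_sq_eq]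
    simp
  simp only [← sq, h2, smul_eq_mul, mul_one] at h1
  exact h1

lemma lamMin_mul_le (hA : A.IsHermitian) (u : Fin p → ℝ) :
    lamMin A * ∑ i, u i ^ 2 ≤ u ⬝ᵥ A *ᵥ u := by
  have hbdd : BddBelow (spectrum ℝ A) := by
    rw [hA.spectrum_real_eq_range_eigenvalues]
    exact (Set.finite_range _).bddBelow
  rw [← dotProduct_cfc_const_mulVec hA]
  refine (dotProduct_cfc_mulVec_mono hA (g := id) (fun x hx => ?_) u).trans_eq ?_
  · exact csInf_le hbdd hx
  · rw [cfc_id ℝ A hA.isSelfAdjoint]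

/-- The entries of a symmetric matrix between `0` and `r • 1` are at most `r`. -/
lemma abs_apply_le_of_dotProduct_le {D : Matrix (Fin p) (Fin p) ℝ} (hD : Dᵀ = D) {r : ℝ}
    (h0 : ∀ u, 0 ≤ u ⬝ᵥ D *ᵥ u) (hr : ∀ u, u ⬝ᵥ D *ᵥ u ≤ r * ∑ i, u i ^ 2) (j k : Fin p) :
    |D j k| ≤ r := by
  have hdiag : ∀ i, D i i ≤ r := by
    intro i
    have := hr (Pi.single i 1)
    simpa [Pi.single_apply, ite_pow] using this
  have hsymm : D k j = D j k := by conv_lhs => rw [← hD, Matrix.transpose_apply]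
  -- Positivity on `e_j ± e_k` bounds an off-diagonal entry by the mean of two diagonal ones.
  have h1 := h0 (Pi.single j 1 + Pi.single k 1)
  have h2 := h0 (Pi.single j 1 - Pi.single k 1)
  simp only [Matrix.mulVec_add, Matrix.mulVec_sub, add_dotProduct, sub_dotProduct, dotProduct_add,
    dotProduct_sub, Matrix.mulVec_single, MulOpposite.op_one, one_smul,
    single_dotProduct, one_mul, Matrix.col_apply, hsymm] at h1 h2
  have := hdiag j
  have := hdiag k
  rw [abs_le]
  constructor <;> linarith

/-! ### The calibrated matrix and its square-root data -/

variable {ε : ℝ}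

lemma calSigma_transpose : (calSigma A ε)ᵀ = calSigma A ε := cfc_transpose _

lemma le_calSigma (hA : A.IsHermitian) (u : Fin p → ℝ) :
    u ⬝ᵥ A *ᵥ u ≤ u ⬝ᵥ calSigma A ε *ᵥ u := by
  conv_lhs => rw [← cfc_id ℝ A hA.isSelfAdjoint]
  exact dotProduct_cfc_mulVec_mono hA (fun x _ => le_max_left _ _) u

lemma mul_le_calSigma (hA : A.IsHermitian) (u : Fin p → ℝ) :
    ε * ∑ i, u i ^ 2 ≤ u ⬝ᵥ calSigma A ε *ᵥ u := by
  rw [← dotProduct_cfc_const_mulVec hA]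
  exact dotProduct_cfc_mulVec_mono hA (fun x _ => le_max_right _ _) u

/-- The calibration moves each entry by at most `ε - r` if `r ≤ ε` is below the spectrum. -/
lemma abs_calSigma_sub_le (hA : A.IsHermitian) {r : ℝ} (hrε : r ≤ ε)
    (h : ∀ u, r * ∑ i, u i ^ 2 ≤ u ⬝ᵥ A *ᵥ u) (j k : Fin p) :
    |(calSigma A ε - A) j k| ≤ ε - r := by
  -- The difference is itself a function of `A`, with values in `[0, ε - r]` on the spectrum.
  have hD : calSigma A ε - A = cfc (fun t : ℝ => max t ε - t) A := by
    refine Eq.trans ?_ (cfc_sub (fun t : ℝ => max t ε) id A (by fun_prop) (by fun_prop)).symm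
    rw [cfc_id ℝ A hA.isSelfAdjoint, calSigma]
  rw [hD]
  refine abs_apply_le_of_dotProduct_le (cfc_transpose _) (fun u => ?_) (fun u => ?_) j k
  · refine le_trans (le_of_eq ?_) (dotProduct_cfc_mulVec_mono hA (f := fun _ => (0 : ℝ))
      (fun x _ => sub_nonneg.2 (le_max_left _ _)) u)
    rw [dotProduct_cfc_const_mulVec hA, zero_mul]
  · rw [← dotProduct_cfc_const_mulVec hA]
    refine dotProduct_cfc_mulVec_mono hA (fun x hx => ?_) u
    have := le_of_mem_spectrum hA h hx
    rw [sub_le_iff_le_add, max_le_iff]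
    constructor <;> linarith

lemma calZ_mul_calZ (n : ℕ) (hε : 0 < ε) : calZ n A ε * calZ n A ε = (n : ℝ) • calSigma A ε := by
  rw [calZ, calSigma, Matrix.smul_mul, Matrix.mul_smul, smul_smul,
    Real.mul_self_sqrt (Nat.cast_nonneg n)]
  congr 1
  rw [← cfc_mul _ _ A (by fun_prop) (by fun_prop)]
  exact cfc_congr fun t _ => Real.mul_self_sqrt (hε.le.trans (le_max_right _ _))

lemma calZ_mulVec_calY (n : ℕ) (hA : A.IsHermitian) (hε : 0 < ε) (ξ : Fin p → ℝ) :
    calZ n A ε *ᵥ calY n A ε ξ = (n : ℝ) • ξ := by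
  rw [calZ, calY, Matrix.smul_mulVec, Matrix.mulVec_smul, smul_smul,
    Real.mul_self_sqrt (Nat.cast_nonneg n), Matrix.mulVec_mulVec]
  have hpos : ∀ t : ℝ, 0 < √(max t ε) := fun t =>
    Real.sqrt_pos.2 (hε.trans_le (le_max_right _ _))
  have hcont : Continuous fun t : ℝ => 1 / √(max t ε) :=
    continuous_const.div (by fun_prop) fun t => (hpos t).ne'
  rw [← cfc_mul _ _ A (by fun_prop) hcont.continuousOn,
    cfc_congr (g := fun _ => (1 : ℝ)) (fun t _ => mul_one_div_cancel (hpos t).ne'),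
    cfc_const_one ℝ A hA.isSelfAdjoint, Matrix.one_mulVec]

/-- The calibrated loss as a quadratic function. -/
lemma lsLoss_calibrated {n : ℕ} (hn : 0 < n) (hA : A.IsHermitian) (hε : 0 < ε)
    (ξ v : Fin p → ℝ) :
    lsLoss n (calZ n A ε) (calY n A ε ξ) v = quadLoss (calSigma A ε) ξ v +
      1 / (2 * (n : ℝ)) * (calY n A ε ξ ⬝ᵥ calY n A ε ξ) := by
  have hn' : (n : ℝ) ≠ 0 := by exact_mod_cast hn.ne'
  have hZ : (calZ n A ε)ᵀ = calZ n A ε := by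
    rw [calZ, Matrix.transpose_smul, cfc_transpose]
  have h1 : (calZ n A ε *ᵥ v) ⬝ᵥ (calZ n A ε *ᵥ v) = n * (v ⬝ᵥ calSigma A ε *ᵥ v) := by
    rw [dotProduct_comm, ← dotProduct_mulVec_symm hZ, Matrix.mulVec_mulVec,
      calZ_mul_calZ n hε, Matrix.smul_mulVec, dotProduct_smul, smul_eq_mul]
  have h2 : (calZ n A ε *ᵥ v) ⬝ᵥ calY n A ε ξ = n * (ξ ⬝ᵥ v) := by
    rw [dotProduct_comm, dotProduct_mulVec_symm hZ, calZ_mulVec_calY n hA hε, dotProduct_smul,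
      smul_eq_mul, dotProduct_comm]
  have h3 : ∑ i, ((calZ n A ε *ᵥ v) i - calY n A ε ξ i) ^ 2 =
      (calZ n A ε *ᵥ v) ⬝ᵥ (calZ n A ε *ᵥ v) - 2 * ((calZ n A ε *ᵥ v) ⬝ᵥ calY n A ε ξ) +
        calY n A ε ξ ⬝ᵥ calY n A ε ξ := by
    simp only [dotProduct, Finset.mul_sum, ← Finset.sum_sub_distrib, ← Finset.sum_add_distrib]
    exact Finset.sum_congr rfl fun i _ => by ring
  rw [lsLoss, h3, h1, h2, quadLoss]
  field_simp

end Calibration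

/-! ### The oracle residual -/

section Residual

variable {p : ℕ}

lemma abs_mulVec_le_card_mul {m ι : Type*} [Fintype ι] [Finite m] (B : Matrix m ι ℝ) {g : ι → ℝ}
    {N : ℝ} (hg : ∀ i, |g i| ≤ N) (j : m) :
    |(B *ᵥ g) j| ≤ Fintype.card ι * maxNorm B * N := by
  have hB : ∀ i, |B j i| ≤ maxNorm B := fun i =>
    le_ciSup (f := fun ij : m × ι => |B ij.1 ij.2|) (Set.finite_range _).bddAbove (j, i)
  calc |(B *ᵥ g) j| ≤ ∑ i, |B j i * g i| := Finset.abs_sum_le_sum_abs _ _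
    _ ≤ ∑ _i : ι, maxNorm B * N := Finset.sum_le_sum fun i _ => by
        rw [abs_mul]
        exact mul_le_mul (hB i) (hg i) (abs_nonneg _) ((abs_nonneg _).trans (hB i))
    _ = Fintype.card ι * maxNorm B * N := by
        rw [Finset.sum_const, Finset.card_univ, nsmul_eq_mul, mul_assoc]

lemma mulVec_eq_sum_of_supp {m : Type*} {H : Matrix m (Fin p) ℝ} {S : Finset (Fin p)}
    {d : Fin p → ℝ} (hd : ∀ i, i ∉ S → d i = 0) (j : m) :
    (H *ᵥ d) j = ∑ i : {i // i ∈ S}, H j i * d i := by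
  rw [Matrix.mulVec, dotProduct, ← Finset.sum_subset (Finset.subset_univ S)
    (fun i _ hi => by rw [hd i hi, mul_zero]), Finset.sum_coe_sort S fun i => H j i * d i]

/-- The error and the residual of the oracle estimator in terms of the noise level. -/
lemma oracle_bounds {H : Matrix (Fin p) (Fin p) ℝ} {S : Finset (Fin p)} {ε N : ℝ} (hε : 0 < ε)
    (hpd : ∀ u, ε * ∑ i, u i ^ 2 ≤ u ⬝ᵥ H *ᵥ u) {ξ bstar c : Fin p → ℝ}
    (hb : ∀ i, i ∉ S → bstar i = 0) (hc : ∀ i, i ∉ S → c i = 0)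
    (hr : ∀ i ∈ S, (ξ - H *ᵥ c) i = 0) (hN : ∀ i, |(ξ - H *ᵥ bstar) i| ≤ N) :
    (∀ i ∈ S, |c i - bstar i| ≤ Kdoubleprime H S N) ∧
      ∀ i, |(ξ - H *ᵥ c) i| ≤ N * (1 + (S.card : ℝ) * maxNorm (Gmat H S)) := by
  set d : Fin p → ℝ := c - bstar with hd
  set g := ξ - H *ᵥ bstar with hg
  have hdS : ∀ i, i ∉ S → d i = 0 := fun i hi => by simp [hd, hb i hi, hc i hi]
  have hres : ξ - H *ᵥ c = g - H *ᵥ d := by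
    rw [hd, Matrix.mulVec_sub, hg]; abel
  set dS : {i // i ∈ S} → ℝ := fun i => d i with hdSdef
  set gS : {i // i ∈ S} → ℝ := fun i => g i with hgS
  set B := H.toBlock (· ∈ S) (· ∈ S) with hB
  -- The normal equations on S.
  have hBd : B *ᵥ dS = gS := by
    funext i
    have h1 := hr i i.2
    rw [hres, Pi.sub_apply, mulVec_eq_sum_of_supp hdS, sub_eq_zero] at h1
    exact h1.symm
  -- A kernel vector of the block, extended by zero, has zero quadratic form and hence vanishes by
  -- positive definiteness of `H`.
  have hBunit : IsUnit B := by
    rw [← Matrix.mulVec_injective_iff_isUnit]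
    rw [← Matrix.coe_mulVecLin, injective_iff_map_eq_zero]
    intro u hu
    rw [Matrix.mulVecLin_apply] at hu
    set v : Fin p → ℝ := fun i => if hi : i ∈ S then u ⟨i, hi⟩ else 0 with hv
    have hvS : ∀ i, i ∉ S → v i = 0 := fun i hi => by simp [hv, hi]
    have hvu : ∀ i : {i // i ∈ S}, v i = u i := fun i => by simp [hv]
    have hquad : v ⬝ᵥ H *ᵥ v = 0 := by
      refine Finset.sum_eq_zero fun i _ => ?_
      by_cases hi : i ∈ S
      · have h1 := congrFun hu ⟨i, hi⟩
        rw [mulVec_eq_sum_of_supp hvS]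
        simp only [hvu]
        have h2 : ∑ x : {i // i ∈ S}, H i x * u x = 0 := h1
        rw [h2, mul_zero]
      · rw [hvS i hi, zero_mul]
    have h1 := hpd v
    rw [hquad] at h1
    have h2 : ∑ i, v i ^ 2 = 0 := le_antisymm
      (nonpos_of_mul_nonpos_right h1 hε) (Finset.sum_nonneg fun i _ => sq_nonneg _)
    have h3 := (Finset.sum_eq_zero_iff_of_nonneg fun i _ => sq_nonneg _).1 h2
    funext i
    rw [← hvu]
    exact pow_eq_zero_iff two_ne_zero |>.1 (h3 i (Finset.mem_univ _))
  have hBdet : IsUnit B.det := (Matrix.isUnit_iff_isUnit_det B).1 hBunit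
  have hdS' : dS = blockInv H S *ᵥ gS := by
    rw [← hBd, blockInv, Matrix.mulVec_mulVec, Matrix.nonsing_inv_mul _ hBdet, Matrix.one_mulVec]
  have hgSN : ∀ i, |gS i| ≤ N := fun i => hN i
  have hcard : Fintype.card {i // i ∈ S} = S.card := Fintype.card_coe S
  refine ⟨fun i hi => ?_, fun i => ?_⟩
  · have h1 := abs_mulVec_le_card_mul (blockInv H S) hgSN ⟨i, hi⟩
    rw [← hdS', hcard] at h1
    calc |c i - bstar i| ≤ _ := h1
      _ = _ := by rw [Kdoubleprime]; ring
  · have hN0 : 0 ≤ N := (abs_nonneg _).trans (hN i)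
    have hG0 : 0 ≤ maxNorm (Gmat H S) := Real.iSup_nonneg fun _ => abs_nonneg _
    by_cases hi : i ∈ S
    · rw [hr i hi, abs_zero]; positivity
    -- Off S the residual equals `g - G g_S`, since `d_S = H_SS⁻¹ g_S`.
    · have h1 := abs_mulVec_le_card_mul (Gmat H S) hgSN ⟨i, hi⟩
      rw [Gmat, ← Matrix.mulVec_mulVec, ← hdS', hcard] at h1
      have h2 : (H.toBlock (· ∉ S) (· ∈ S) *ᵥ dS) ⟨i, hi⟩ = (H *ᵥ d) i := by
        rw [mulVec_eq_sum_of_supp hdS]; rfl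
      rw [h2] at h1
      rw [hres, Pi.sub_apply]
      have h3 := abs_sub (g i) ((H *ᵥ d) i)
      have h4 := hN i
      rw [← Gmat] at h1
      linarith

end Residual

/-! ### Concentration -/

section Concentration

variable {Ω : Type*} [MeasurableSpace Ω] {P : Measure Ω}

/-- Replaces the differing parameters `a i ^ 2 * c` of weighted summands by a common one. -/
lemma hasSubgaussianMGF_of_le {Y : Ω → ℝ} {c c' : ℝ≥0} (h : HasSubgaussianMGF Y c P)
    (hcc' : c ≤ c') : HasSubgaussianMGF Y c' P where
  integrable_exp_mul := h.integrable_exp_mul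
  mgf_le t := (h.mgf_le t).trans (Real.exp_le_exp.2 (by gcongr))

lemma HasSubgaussianMGF.measureReal_le_abs [IsFiniteMeasure P] {Y : Ω → ℝ} {c : ℝ≥0}
    (h : HasSubgaussianMGF Y c P) {t : ℝ} (ht : 0 ≤ t) :
    P.real {ω | t ≤ |Y ω|} ≤ 2 * Real.exp (-t ^ 2 / (2 * c)) := by
  have h1 := h.measure_ge_le ht
  have h2 := h.neg.measure_ge_le ht
  have hsub : {ω | t ≤ |Y ω|} ⊆ {ω | t ≤ Y ω} ∪ {ω | t ≤ (-Y) ω} := fun ω hω => by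
    simpa [le_abs] using hω
  have := (measureReal_mono hsub).trans (measureReal_union_le (μ := P) _ _)
  linarith

/-- Two-sided tail bound for a sum of `n` independent sub-Gaussian variables. -/
lemma measureReal_le_abs_sum [IsFiniteMeasure P] {n : ℕ} (hn : 0 < n) {Y : Fin n → Ω → ℝ}
    (hindep : iIndepFun Y P) {c : ℝ≥0} (hY : ∀ i, HasSubgaussianMGF (Y i) c P) {t : ℝ}
    (ht : 0 ≤ t) :
    P.real {ω | n * t ≤ |∑ i, Y i ω|} ≤ 2 * Real.exp (-(n * t ^ 2 / (2 * c))) := by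
  have h := HasSubgaussianMGF.measureReal_le_abs
    (HasSubgaussianMGF.sum_of_iIndepFun hindep (s := Finset.univ) (c := fun _ => c)
      fun i _ => hY i) (t := n * t) (by positivity)
  refine h.trans (le_of_eq ?_)
  congr 2
  have hn' : (n : ℝ) ≠ 0 := by exact_mod_cast hn.ne'
  simp only [Finset.sum_const, Finset.card_univ, Fintype.card_fin, nsmul_eq_mul, NNReal.coe_mul,
    NNReal.coe_natCast]
  rw [neg_div, show (n * t) ^ 2 = n * (n * t ^ 2) by ring,
    show 2 * ((n : ℝ) * c) = n * (2 * c) by ring, mul_div_mul_left _ _ hn']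

/-- Hoeffding's inequality for bounded variables. -/
lemma measureReal_le_abs_sum_sub_of_bounded [IsProbabilityMeasure P] {n : ℕ} (hn : 0 < n)
    {Y : Fin n → Ω → ℝ} (hmeas : ∀ i, Measurable (Y i)) (hindep : iIndepFun Y P) {L : ℝ}
    (hL : 0 ≤ L) (hbdd : ∀ᵐ ω ∂P, ∀ i, |Y i ω| ≤ L) {y : Fin n → ℝ}
    (hmean : ∀ i, ∫ ω, Y i ω ∂P = y i) {t : ℝ} (ht : 0 ≤ t) :
    P.real {ω | n * t ≤ |∑ i, (Y i ω - y i)|} ≤ 2 * Real.exp (-(n * t ^ 2 / (2 * L ^ 2))) := by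
  have hsub : ∀ i, HasSubgaussianMGF (fun ω => Y i ω - y i) ((‖L - -L‖₊ / 2) ^ 2) P := by
    intro i
    rw [← hmean i]
    refine hasSubgaussianMGF_of_mem_Icc (hmeas i).aemeasurable ?_
    filter_upwards [hbdd] with ω hω using abs_le.1 (hω i)
  have h := measureReal_le_abs_sum hn
    (hindep.comp (fun i x => x - y i) fun i => by fun_prop) hsub ht
  have hc : (((‖L - -L‖₊ / 2) ^ 2 : ℝ≥0) : ℝ) = L ^ 2 := by
    push_cast
    rw [Real.norm_eq_abs, sub_neg_eq_add, abs_of_nonneg (by linarith)]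
    ring
  rw [hc] at h
  exact h

/-- Tail bound for a sum of independent sub-Gaussian variables with bounded random weights that
are independent of them. -/
lemma measureReal_le_abs_sum_weighted [IsProbabilityMeasure P] {n : ℕ} (hn : 0 < n)
    {𝓜 : Type*} [MeasurableSpace 𝓜] {V : Ω → 𝓜} {e : Fin n → Ω → ℝ} (hV : Measurable V)
    (he : ∀ i, Measurable (e i)) (hindep : iIndepFun e P)
    (hVe : IndepFun V (fun ω i => e i ω) P) {c : ℝ≥0} (hsub : ∀ i, HasSubgaussianMGF (e i) c P)
    {W : 𝓜 → Fin n → ℝ} (hW : Measurable W) {L : ℝ}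
    (hbdd : ∀ᵐ ω ∂P, ∀ i, |W (V ω) i| ≤ L) {t : ℝ} (ht : 0 ≤ t) :
    P.real {ω | n * t ≤ |∑ i, W (V ω) i * e i ω|} ≤
      2 * Real.exp (-(n * t ^ 2 / (2 * (L ^ 2 * c)))) := by
  set B := 2 * Real.exp (-(n * t ^ 2 / (2 * (L ^ 2 * c)))) with hB
  have he' : Measurable fun ω i => e i ω := measurable_pi_lambda _ he
  have hfix : ∀ a : Fin n → ℝ, (∀ i, |a i| ≤ L) →
      P.real {ω | n * t ≤ |∑ i, a i * e i ω|} ≤ B := by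
    intro a ha
    have haL : ∀ i, (⟨a i ^ 2, sq_nonneg (a i)⟩ : ℝ≥0) ≤ ⟨L ^ 2, sq_nonneg L⟩ := fun i =>
      sq_le_sq' (abs_le.1 (ha i)).1 (abs_le.1 (ha i)).2
    have h := measureReal_le_abs_sum hn (hindep.comp (fun i x => a i * x) fun i => by fun_prop)
      (c := ⟨L ^ 2, sq_nonneg L⟩ * c) (fun i => hasSubgaussianMGF_of_le ((hsub i).const_mul (a i))
        (mul_le_mul_of_nonneg_right (haL i) zero_le)) ht
    exact h
  set T : Set (𝓜 × (Fin n → ℝ)) := {z | n * t ≤ |∑ i, W z.1 i * z.2 i|} with hT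
  have hWi : ∀ i, Measurable fun m => W m i := fun i => (measurable_pi_apply i).comp hW
  have hTmeas : MeasurableSet T := by
    refine measurableSet_le measurable_const ?_
    refine Measurable.abs (Finset.measurable_sum _ fun i _ => ?_)
    exact ((hWi i).comp measurable_fst).mul ((measurable_pi_apply i).comp measurable_snd)
  have hae : ∀ᵐ m ∂(P.map V), ∀ i, |W m i| ≤ L := by
    rw [ae_map_iff hV.aemeasurable]
    · exact hbdd
    · rw [Set.ofPred_forall]
      exact MeasurableSet.iInter fun i => measurableSet_le (hWi i).abs measurable_const
  have hprob : IsProbabilityMeasure (P.map V) := Measure.isProbabilityMeasure_map hV.aemeasurable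
  -- By independence the joint law is a product, so Fubini reduces to the bound for frozen weights,
  -- which is uniform over almost every value of `V`.
  have hmain : P {ω | n * t ≤ |∑ i, W (V ω) i * e i ω|} ≤ ENNReal.ofReal B := by
    have h1 : P {ω | n * t ≤ |∑ i, W (V ω) i * e i ω|} =
        P.map (fun ω => (V ω, fun i => e i ω)) T :=
      (Measure.map_apply (hV.prodMk he') hTmeas).symm
    rw [h1, (indepFun_iff_map_prod_eq_prod_map_map hV.aemeasurable he'.aemeasurable).1 hVe,
      Measure.prod_apply hTmeas]
    calc ∫⁻ m, (P.map fun ω i => e i ω) (Prod.mk m ⁻¹' T) ∂(P.map V)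
        ≤ ∫⁻ _m, ENNReal.ofReal B ∂(P.map V) := by
          refine lintegral_mono_ae ?_
          filter_upwards [hae] with m hm
          rw [Measure.map_apply he' (measurable_prodMk_left hTmeas)]
          exact (ENNReal.le_ofReal_iff_toReal_le (measure_ne_top _ _) (by positivity)).2
            (hfix (W m) hm)
      _ = ENNReal.ofReal B := by simp
  exact ENNReal.toReal_le_of_le_ofReal (by positivity) hmain

end Concentration

/-! ### The multiplicative error model -/

section Model

lemma corrupted_apply {Ω : Type*} {n p : ℕ} (X : Matrix (Fin n) (Fin p) ℝ)
    (M : Fin n → Ω → Fin p → ℝ) (ω : Ω) (i : Fin n) (j : Fin p) :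
    corrupted X M ω i j = X i j * M i ω j := rfl

variable {Ω : Type*} [MeasurableSpace Ω] {P : Measure Ω} {n p : ℕ}
  {X : Matrix (Fin n) (Fin p) ℝ} {M : Fin n → Ω → Fin p → ℝ} {e : Fin n → Ω → ℝ}
  {bstar muM : Fin p → ℝ} {SM : Matrix (Fin p) (Fin p) ℝ} {τ σ : ℝ≥0} {cX cM m μ₀ : ℝ}

lemma gram_apply (Z : Matrix (Fin n) (Fin p) ℝ) (j k : Fin p) :
    gram Z j k = 1 / (n : ℝ) * ∑ i, Z i j * Z i k := by
  simp [gram, Matrix.mul_apply]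

lemma gram_mulVec_apply (Z : Matrix (Fin n) (Fin p) ℝ) (u : Fin p → ℝ) (j : Fin p) :
    (gram Z *ᵥ u) j = 1 / (n : ℝ) * ∑ i, Z i j * (Z *ᵥ u) i := by
  rw [gram, Matrix.smul_mulVec, ← Matrix.mulVec_mulVec]
  rfl

lemma gram_symm (Z : Matrix (Fin n) (Fin p) ℝ) (j k : Fin p) : gram Z j k = gram Z k j := by
  rw [gram_apply, gram_apply]
  simp only [mul_comm]

lemma abs_mulVec_le_mul_sum {m : Type*} {D : Matrix m (Fin p) ℝ} {r : ℝ} {j : m}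
    (hD : ∀ k, |D j k| ≤ r) (u : Fin p → ℝ) : |(D *ᵥ u) j| ≤ r * ∑ k, |u k| := by
  rw [Finset.mul_sum]
  calc |(D *ᵥ u) j| ≤ ∑ k, |D j k * u k| := by
        rw [Matrix.mulVec, dotProduct]; exact Finset.abs_sum_le_sum_abs _ _
    _ ≤ ∑ k, r * |u k| := Finset.sum_le_sum fun k _ => by
        rw [abs_mul]
        exact mul_le_mul_of_nonneg_right (hD k) (abs_nonneg _)

namespace MulErrorModel

variable (h : MulErrorModel P X M e muM SM τ σ cX cM m μ₀)

include h

lemma n_pos (j : Fin p) : 0 < n := by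
  rcases Nat.eq_zero_or_pos n with rfl | hn
  · simpa using h.normalized j
  · exact hn

lemma measurable_M_apply (i : Fin n) (j : Fin p) : Measurable fun ω => M i ω j :=
  (measurable_pi_apply j).comp (h.M_meas i)

lemma cX_pos (j : Fin p) : 0 < cX := by
  by_contra! hc
  have h0 : ∀ i, X i j = 0 := fun i => abs_nonpos_iff.1 ((h.X_bdd i j).trans hc)
  have := h.normalized j
  simp [h0] at this

lemma secondMoment_pos (j k : Fin p) : 0 < secondMoment SM muM j k :=
  h.m_pos.trans_le (h.m_le j k)

lemma muM_pos (j : Fin p) : 0 < muM j := h.mu_pos.trans_le (h.mu_le j)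

lemma measurable_sigmaHat (j k : Fin p) :
    Measurable fun ω => sigmaHat (corrupted X M ω) SM muM j k := by
  simp only [sigmaHat, Matrix.of_apply, gram_apply, corrupted_apply]
  have := h.measurable_M_apply
  fun_prop

lemma measurable_xiHat (j : Fin p) :
    Measurable fun ω => xiHat (corrupted X M ω) (response X bstar e ω) muM j := by
  simp only [xiHat, Matrix.mulVec, dotProduct, Matrix.transpose_apply, corrupted_apply, response]
  have := h.measurable_M_apply
  have := h.e_meas
  fun_prop

variable [IsProbabilityMeasure P]

lemma memLp_M_apply (i : Fin n) (j : Fin p) : MemLp (fun ω => M i ω j) 2 P :=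
  MemLp.of_bound (h.measurable_M_apply i j).aestronglyMeasurable cM
    (h.M_bdd.mono fun _ hω => hω i j)

lemma cM_pos (j : Fin p) : 0 < cM := by
  have i : Fin n := ⟨0, h.n_pos j⟩
  have h1 : ∫ ω, M i ω j ∂P ≤ ∫ _ω, cM ∂P :=
    integral_mono_ae ((h.memLp_M_apply i j).integrable (by norm_num)) (integrable_const _)
      (h.M_bdd.mono fun _ hω => (le_abs_self _).trans (hω i j))
  rw [h.M_mean, integral_const, probReal_univ, one_smul] at h1
  exact h.mu_pos.trans_le ((h.mu_le j).trans h1)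

lemma integral_M_mul_M (i : Fin n) (j k : Fin p) :
    ∫ ω, M i ω j * M i ω k ∂P = secondMoment SM muM j k := by
  have h1 := h.M_cov i j k
  rw [covariance_eq_sub (h.memLp_M_apply i j) (h.memLp_M_apply i k), h.M_mean, h.M_mean] at h1
  simp only [Pi.mul_apply] at h1
  rw [secondMoment, Matrix.add_apply, Matrix.vecMulVec_apply]
  linarith

lemma secondMoment_symm (j k : Fin p) :
    secondMoment SM muM j k = secondMoment SM muM k j := by
  have i : Fin n := ⟨0, h.n_pos j⟩
  rw [← h.integral_M_mul_M i, ← h.integral_M_mul_M i]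
  simp only [mul_comm]

/-- Concentration of the surrogate for the Gram matrix. -/
lemma sigmaHat_tail (j k : Fin p) {t : ℝ} (ht : 0 ≤ t) :
    P.real {ω | t ≤ |sigmaHat (corrupted X M ω) SM muM j k - gram X j k|} ≤
      2 * Real.exp (-(n * (m * t) ^ 2 / (2 * (cX ^ 2 * cM ^ 2) ^ 2))) := by
  have hn := h.n_pos j
  have hn' : (0 : ℝ) < n := by exact_mod_cast hn
  have hsm := h.secondMoment_pos j k
  have hc := h.cX_pos j
  have hcM := h.cM_pos j
  have htail := measureReal_le_abs_sum_sub_of_bounded (P := P) hn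
    (Y := fun i ω => X i j * X i k * (M i ω j * M i ω k))
    (y := fun i => X i j * X i k * secondMoment SM muM j k) (L := cX ^ 2 * cM ^ 2)
    (fun i => by have := h.measurable_M_apply i; fun_prop)
    (h.M_indep.comp (fun i x => X i j * X i k * (x j * x k)) fun i => by fun_prop)
    (by positivity) (by
      filter_upwards [h.M_bdd] with ω hω i
      rw [abs_mul, abs_mul, abs_mul, sq, sq]
      have h1 := h.X_bdd i j
      have h2 := h.X_bdd i k
      have h3 := hω i j
      have h4 := hω i k
      gcongr)
    (fun i => by rw [integral_const_mul, h.integral_M_mul_M]) (t := m * t)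
    (mul_nonneg h.m_pos.le ht)
  refine (measureReal_mono fun ω hω => ?_).trans htail
  simp only [Set.mem_ofPred_eq] at hω ⊢
  -- Undoing the elementwise division costs the factor `secondMoment ≥ m`, hence the level `m * t`.
  have heq : ∑ i, (X i j * X i k * (M i ω j * M i ω k) - X i j * X i k * secondMoment SM muM j k) =
      n * secondMoment SM muM j k * (sigmaHat (corrupted X M ω) SM muM j k - gram X j k) := by
    simp only [sigmaHat, Matrix.of_apply, gram_apply, corrupted_apply]
    rw [Finset.sum_sub_distrib, ← Finset.sum_mul]
    have : ∑ i, X i j * X i k * (M i ω j * M i ω k) =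
        ∑ i, X i j * M i ω j * (X i k * M i ω k) := Finset.sum_congr rfl fun i _ => by ring
    rw [this]
    field_simp
  rw [heq, abs_mul, abs_of_pos (by positivity), mul_assoc]
  refine mul_le_mul_of_nonneg_left ?_ hn'.le
  exact mul_le_mul (h.m_le j k) hω ht hsm.le

/-- Concentration of the surrogate for `Σ β*`. -/
lemma xiHat_tail (j : Fin p) {t : ℝ} (ht : 0 ≤ t) :
    P.real {ω | t ≤ |xiHat (corrupted X M ω) (response X bstar e ω) muM j -
        (gram X *ᵥ bstar) j|} ≤
      2 * Real.exp (-(n * (μ₀ * t / 2) ^ 2 / (2 * (cX * cM * (cX * ∑ i, |bstar i|)) ^ 2))) +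
      2 * Real.exp (-(n * (μ₀ * t / 2) ^ 2 / (2 * ((cX * cM) ^ 2 * (σ : ℝ) ^ 2)))) := by
  have hn := h.n_pos j
  have hn' : (0 : ℝ) < n := by exact_mod_cast hn
  have hmu := h.muM_pos j
  have hc := h.cX_pos j
  have hcM := h.cM_pos j
  have hμ₀ := h.mu_pos
  have hN : 0 ≤ ∑ i, |bstar i| := Finset.sum_nonneg fun i _ => abs_nonneg _
  have hWbdd : ∀ᵐ ω ∂P, ∀ i, |X i j * M i ω j| ≤ cX * cM := by
    filter_upwards [h.M_bdd] with ω hω i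
    rw [abs_mul]
    exact mul_le_mul (h.X_bdd i j) (hω i j) (abs_nonneg _) hc.le
  have htail₁ := measureReal_le_abs_sum_sub_of_bounded (P := P) hn
    (Y := fun i ω => X i j * M i ω j * (X *ᵥ bstar) i)
    (y := fun i => X i j * muM j * (X *ᵥ bstar) i) (L := cX * cM * (cX * ∑ i, |bstar i|))
    (fun i => by have := h.measurable_M_apply i; fun_prop)
    (h.M_indep.comp (fun i x => X i j * x j * (X *ᵥ bstar) i) fun i => by fun_prop)
    (by positivity) (by
      filter_upwards [hWbdd] with ω hω i
      rw [abs_mul]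
      exact mul_le_mul (hω i) (abs_mulVec_le_mul_sum (h.X_bdd i) bstar) (abs_nonneg _)
        (by positivity))
    (fun i => by rw [integral_mul_const, integral_const_mul, h.M_mean]) (t := μ₀ * t / 2)
    (by positivity)
  have htail₂ := measureReal_le_abs_sum_weighted (P := P) hn (V := fun ω i => M i ω)
    (measurable_pi_lambda _ h.M_meas) h.e_meas h.e_indep h.indep h.e_subG
    (W := fun x i => X i j * x i j) (by fun_prop) (L := cX * cM) hWbdd
    (t := μ₀ * t / 2) (by positivity)
  rw [NNReal.coe_pow] at htail₂
  refine (measureReal_mono (fun ω hω => ?_)).trans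
    ((measureReal_union_le _ _).trans (add_le_add htail₁ htail₂))
  simp only [Set.mem_union, Set.mem_ofPred_eq] at hω ⊢
  -- `A₁` is the fluctuation of `M` and `A₂` the noise; each is allowed half of the deviation.
  set A₁ := ∑ i, (X i j * M i ω j * (X *ᵥ bstar) i - X i j * muM j * (X *ᵥ bstar) i) with hA₁
  set A₂ := ∑ i, X i j * M i ω j * e i ω with hA₂
  have heq : A₁ + A₂ = n * muM j *
      (xiHat (corrupted X M ω) (response X bstar e ω) muM j - (gram X *ᵥ bstar) j) := by
    have h1 : A₁ + A₂ = ∑ i, X i j * M i ω j * ((X *ᵥ bstar) i + e i ω) -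
        muM j * ∑ i, X i j * (X *ᵥ bstar) i := by
      rw [hA₁, hA₂, Finset.mul_sum, ← Finset.sum_add_distrib, ← Finset.sum_sub_distrib]
      exact Finset.sum_congr rfl fun i _ => by ring
    have h2 : ((corrupted X M ω)ᵀ *ᵥ response X bstar e ω) j =
        ∑ i, X i j * M i ω j * ((X *ᵥ bstar) i + e i ω) := rfl
    rw [h1, xiHat, h2, gram_mulVec_apply]
    field_simp
  have hlow : n * (μ₀ * t) ≤ |A₁ + A₂| := by
    rw [heq, abs_mul, abs_of_pos (by positivity), mul_assoc]
    exact mul_le_mul_of_nonneg_left (mul_le_mul (h.mu_le j) hω ht hmu.le) hn'.le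
  have htri := abs_add_le A₁ A₂
  by_contra! hcon
  linarith [hcon.1, hcon.2]

end MulErrorModel

end Model

/-! ### Transfer of the restricted eigenvalue condition -/

section Transfer

variable {p : ℕ}

lemma abs_dotProduct_mulVec_le {D : Matrix (Fin p) (Fin p) ℝ} {r : ℝ}
    (hD : ∀ j k, |D j k| ≤ r) (u : Fin p → ℝ) :
    |u ⬝ᵥ D *ᵥ u| ≤ r * (∑ k, |u k|) ^ 2 := by
  calc |u ⬝ᵥ D *ᵥ u| ≤ ∑ j, |u j * (D *ᵥ u) j| := Finset.abs_sum_le_sum_abs _ _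
    _ ≤ ∑ j, |u j| * (r * ∑ k, |u k|) := Finset.sum_le_sum fun j _ => by
        rw [abs_mul]
        exact mul_le_mul_of_nonneg_left (abs_mulVec_le_mul_sum (hD j) u) (abs_nonneg _)
    _ = r * (∑ k, |u k|) ^ 2 := by rw [← Finset.sum_mul]; ring

/-- The cone gives `‖u‖₁ ≤ 4‖u_{S'}‖₁`, and Cauchy–Schwarz with `|S'| ≤ 1.5|S|` gives `16 · 1.5 =
24`. -/
lemma sq_sum_abs_le_of_mem_coneSet {S : Finset (Fin p)} {u : Fin p → ℝ} (hu : u ∈ coneSet S) :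
    (∑ k, |u k|) ^ 2 ≤ 24 * (S.card : ℝ) * ∑ k, u k ^ 2 := by
  obtain ⟨S', -, hcard, hcone⟩ := hu
  have h1 : ∑ k, |u k| ≤ 4 * ∑ k ∈ S', |u k| := by
    rw [← Finset.sum_add_sum_compl S']
    linarith
  have h2 : (∑ k ∈ S', |u k|) ^ 2 ≤ S'.card * ∑ k, u k ^ 2 := by
    refine sq_sum_le_card_mul_sum_sq.trans (mul_le_mul_of_nonneg_left ?_ (Nat.cast_nonneg _))
    simp only [sq_abs]
    exact Finset.sum_le_sum_of_subset_of_nonneg (Finset.subset_univ _) fun i _ _ => sq_nonneg _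
  have h3 : (S'.card : ℝ) * ∑ k, u k ^ 2 ≤ 1.5 * (S.card : ℝ) * ∑ k, u k ^ 2 :=
    mul_le_mul_of_nonneg_right hcard (Finset.sum_nonneg fun i _ => sq_nonneg _)
  have h4 := pow_le_pow_left₀ (Finset.sum_nonneg fun k _ => abs_nonneg (u k)) h1 2
  rw [mul_pow] at h4
  linarith

/-- The restricted eigenvalue condition is stable under entrywise small perturbations. -/
lemma REC.of_perturbation {G A H : Matrix (Fin p) (Fin p) ℝ} {S : Finset (Fin p)} {κ t : ℝ}
    (hG : REC G S κ) (ht : ∀ j k, |(A - G) j k| ≤ t) (htκ : 24 * (S.card : ℝ) * t ≤ κ / 2)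
    (ht0 : 0 ≤ t) (hAH : ∀ u, u ⬝ᵥ A *ᵥ u ≤ u ⬝ᵥ H *ᵥ u) : REC H S (κ / 2) := by
  refine ⟨half_pos hG.1, fun u hu => ?_⟩
  have h1 := hG.2 u hu
  have h2 := (abs_le.1 (abs_dotProduct_mulVec_le ht u)).1
  rw [Matrix.sub_mulVec, dotProduct_sub] at h2
  have h3 := mul_le_mul_of_nonneg_left (sq_sum_abs_le_of_mem_coneSet hu) ht0
  have h4 := mul_le_mul_of_nonneg_right htκ (Finset.sum_nonneg fun k _ => sq_nonneg (u k) :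
    0 ≤ ∑ k, u k ^ 2)
  have h5 := hAH u
  linarith

/-- The quadratic form of the surrogate is bounded below through the smallest eigenvalue of
`Σ_M†`. -/
lemma le_dotProduct_sigmaHat {n : ℕ} {Z : Matrix (Fin n) (Fin p) ℝ}
    {SM : Matrix (Fin p) (Fin p) ℝ} {muM : Fin p → ℝ} {r : ℝ}
    (hsymm : (sigmaDagger SM muM).IsHermitian) (hZ : ∀ j, 1 / (n : ℝ) * ∑ i, Z i j ^ 2 ≤ r)
    (u : Fin p → ℝ) :
    min (lamMin (sigmaDagger SM muM)) 0 * r * ∑ j, u j ^ 2 ≤ u ⬝ᵥ sigmaHat Z SM muM *ᵥ u := by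
  set D := sigmaDagger SM muM with hD
  set l := min (lamMin D) 0 with hl
  -- The surrogate is the average over rows of `Diag(Z_i) Σ_M† Diag(Z_i)`. Truncating `lamMin` at
  -- `0` makes `l ≤ 0`, so the upper bound on the column norms can be used below.
  have hquad : u ⬝ᵥ sigmaHat Z SM muM *ᵥ u =
      1 / (n : ℝ) * ∑ i, ((fun j => u j * Z i j) ⬝ᵥ D *ᵥ fun j => u j * Z i j) := by
    simp only [dotProduct, Matrix.mulVec, sigmaHat, Matrix.of_apply, gram_apply, hD, sigmaDagger,
      Finset.mul_sum, Finset.sum_mul, Finset.sum_div]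
    conv_rhs => rw [Finset.sum_comm]
    refine Finset.sum_congr rfl fun j _ => ?_
    conv_rhs => rw [Finset.sum_comm]
    refine Finset.sum_congr rfl fun k _ => Finset.sum_congr rfl fun i _ => ?_
    ring
  have hrow : ∀ i, l * ∑ j, (u j * Z i j) ^ 2 ≤
      (fun j => u j * Z i j) ⬝ᵥ D *ᵥ fun j => u j * Z i j := fun i =>
    (mul_le_mul_of_nonneg_right (min_le_left _ _)
      (Finset.sum_nonneg fun j _ => sq_nonneg _)).trans (lamMin_mul_le hsymm _)
  have hsum : 1 / (n : ℝ) * ∑ i, ∑ j, (u j * Z i j) ^ 2 ≤ r * ∑ j, u j ^ 2 := by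
    rw [Finset.sum_comm, Finset.mul_sum, Finset.mul_sum]
    refine Finset.sum_le_sum fun j _ => ?_
    simp only [mul_pow, ← Finset.mul_sum]
    have := mul_le_mul_of_nonneg_left (hZ j) (sq_nonneg (u j))
    linarith
  calc l * r * ∑ j, u j ^ 2 = l * (r * ∑ j, u j ^ 2) := mul_assoc _ _ _
    _ ≤ l * (1 / (n : ℝ) * ∑ i, ∑ j, (u j * Z i j) ^ 2) :=
        mul_le_mul_of_nonpos_left hsum (min_le_right _ _)
    _ = 1 / (n : ℝ) * ∑ i, l * ∑ j, (u j * Z i j) ^ 2 := by rw [← Finset.mul_sum]; ring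
    _ ≤ 1 / (n : ℝ) * ∑ i, ((fun j => u j * Z i j) ⬝ᵥ D *ᵥ fun j => u j * Z i j) :=
        mul_le_mul_of_nonneg_left (Finset.sum_le_sum fun i _ => hrow i) (by positivity)
    _ = u ⬝ᵥ sigmaHat Z SM muM *ᵥ u := hquad.symm

lemma supp_nonempty {b : Fin p → ℝ} (hb : b ≠ 0) : (supp b).Nonempty := by
  obtain ⟨i, hi⟩ := Function.ne_iff.1 hb
  exact ⟨i, by simpa [supp] using hi⟩

end Transfer

/-- The deterministic content of the result: closeness of the surrogates implies recovery. -/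
theorem eventuallyOracle_of_close {n p : ℕ} (hn : 0 < n) {X Z : Matrix (Fin n) (Fin p) ℝ}
    {y : Fin n → ℝ} {bstar muM : Fin p → ℝ} {SM : Matrix (Fin p) (Fin p) ℝ} {cM ε κ t₁ t₂ : ℝ}
    (hbstar : bstar ≠ 0) (hε : 0 < ε)
    (hsymm : ∀ j k, secondMoment SM muM j k = secondMoment SM muM k j)
    (hRE : REC (gram X) (supp bstar) κ) (hZ : ∀ j, 1 / (n : ℝ) * ∑ i, Z i j ^ 2 ≤ cM ^ 2)
    (h₁ : ∀ j k, |sigmaHat Z SM muM j k - gram X j k| ≤ t₁)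
    (h₂ : ∀ j, |xiHat Z y muM j - (gram X *ᵥ bstar) j| ≤ t₂)
    (ht₁ : 0 ≤ t₁) (ht₁κ : 24 * ((supp bstar).card : ℝ) * t₁ ≤ κ / 2)
    (ht : t₁ * ∑ i, |bstar i| + t₂ ≤
      (ε - min (lamMin (sigmaDagger SM muM)) 0 * cM ^ 2) * ∑ i, |bstar i|) :
    EventuallyOracle Z y bstar muM SM cM ε κ := by
  unfold EventuallyOracle
  intro A St Zt yt S K lam a b w ρ bLS hrun hLS hlam hρ1 hρ3 k hk
  have hA : A.IsHermitian := by
    refine Matrix.IsHermitian.ext fun j k => ?_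
    simp only [A, sigmaHat, Matrix.of_apply, star_trivial, hsymm j k, gram_symm Z j k]
  have hD : (sigmaDagger SM muM).IsHermitian := by
    refine Matrix.IsHermitian.ext fun j k => ?_
    simp only [sigmaDagger, Matrix.of_apply, star_trivial, hsymm j k]
  have hS : S.Nonempty := supp_nonempty hbstar
  set l := min (lamMin (sigmaDagger SM muM)) 0 * cM ^ 2 with hl
  have hl0 : l ≤ 0 := mul_nonpos_of_nonpos_of_nonneg (min_le_right _ _) (sq_nonneg _)
  have hquad : ∀ u, l * ∑ i, u i ^ 2 ≤ u ⬝ᵥ A *ᵥ u := le_dotProduct_sigmaHat hD hZ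
  have hcal : ∀ j k, |(St - A) j k| ≤ ε - l := abs_calSigma_sub_le hA (by linarith) hquad
  have hpd : ∀ u, ε * ∑ i, u i ^ 2 ≤ u ⬝ᵥ St *ᵥ u := mul_le_calSigma hA
  have hpsd : ∀ u, 0 ≤ u ⬝ᵥ St *ᵥ u := fun u =>
    (mul_nonneg hε.le (Finset.sum_nonneg fun i _ => sq_nonneg _)).trans (hpd u)
  -- Only a lower bound is needed, so the perturbation is paid for `A` alone; calibration raises the
  -- form.
  have hRESt : REC St S (κ / 2) := hRE.of_perturbation h₁ ht₁κ ht₁ (le_calSigma hA)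
  set ξ := xiHat Z y muM with hξ
  have hnoise : ∀ i, |(ξ - St *ᵥ bstar) i| ≤ K := by
    intro i
    -- The two sampling errors together cost one `(ε - l)‖β*‖₁` and calibration another, which
    -- accounts for the factor `2` in `Ktilde`.
    have h3 : (ξ - St *ᵥ bstar) i = (ξ i - (gram X *ᵥ bstar) i) -
        ((A - gram X) *ᵥ bstar) i - ((St - A) *ᵥ bstar) i := by
      simp only [Matrix.sub_mulVec, Pi.sub_apply]
      ring
    have h4 := abs_mulVec_le_mul_sum (D := A - gram X) (j := i) (h₁ i) bstar
    have h5 := abs_mulVec_le_mul_sum (hcal i) bstar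
    have h6 := h₂ i
    have h7 := abs_sub ((ξ i - (gram X *ᵥ bstar) i) - ((A - gram X) *ᵥ bstar) i)
      (((St - A) *ᵥ bstar) i)
    have h8 := abs_sub (ξ i - (gram X *ᵥ bstar) i) (((A - gram X) *ᵥ bstar) i)
    have h9 : K = 2 * (ε - l) * ∑ i, |bstar i| := rfl
    rw [h3, h9]
    linarith
  have hloss := fun v => lsLoss_calibrated hn hA hε ξ v
  have hbS : ∀ i, i ∉ S → bstar i = 0 := fun i hi => by simpa [S, supp] using hi
  have hcS : ∀ i, i ∉ S → bLS i = 0 := fun i hi => by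
    by_contra h0
    exact hi (hLS.supp_subset (by simp [supp, h0]))
  have hrS : ∀ i ∈ S, (ξ - St *ᵥ bLS) i = 0 := fun i hi =>
    gradient_eq_zero_of_minimizer calSigma_transpose hLS.supp_subset (fun v hv => by
      have := hLS.le v hv
      rw [hloss, hloss] at this
      linarith) hi
  obtain ⟨hc, hr⟩ := oracle_bounds hε hpd hbS hcS hrS hnoise
  have hK0 : 0 ≤ K := by
    obtain ⟨i, -⟩ := hS
    exact (abs_nonneg _).trans (hnoise i)
  have hr' : ∀ i, |(ξ - St *ᵥ bLS) i| ≤ lam / 6 := by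
    intro i
    have h3 : K * (1 + (S.card : ℝ) * maxNorm (Gmat St S)) ≤ Kprime St S K :=
      mul_le_mul_of_nonneg_left (le_max_right _ _) hK0
    have := hr i
    linarith
  exact hrun.eq_oracle hloss calSigma_transpose hpsd hS hRESt hLS hr' hc hρ1 hρ3 hk

/-! ### The main result -/

/-- Shows that `‖β*‖₁` is a legitimate ingredient of ζ. -/
lemma sum_abs_nonzeroEntries {p : ℕ} (b : Fin p → ℝ) :
    ((nonzeroEntries b).map fun x => |x|).sum = ∑ i, |b i| := by
  rw [nonzeroEntries, Multiset.map_map]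
  refine Finset.sum_subset (Finset.subset_univ (supp b)) fun i _ hi => ?_
  have : b i = 0 := by simpa [supp] using hi
  simp [this]

/-- The probability that the surrogates are uniformly close to their targets. -/
lemma MulErrorModel.exists_good_event {Ω : Type*} [MeasurableSpace Ω] {P : Measure Ω}
    [IsProbabilityMeasure P] {n p : ℕ} {X : Matrix (Fin n) (Fin p) ℝ}
    {M : Fin n → Ω → Fin p → ℝ} {e : Fin n → Ω → ℝ} {muM : Fin p → ℝ}
    {SM : Matrix (Fin p) (Fin p) ℝ} {τ σ : ℝ≥0} {cX cM m μ₀ : ℝ}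
    (h : MulErrorModel P X M e muM SM τ σ cX cM m μ₀) (bstar : Fin p → ℝ) {t₁ t₂ r : ℝ}
    (ht₁ : 0 ≤ t₁) (ht₂ : 0 ≤ t₂) (hr₁ : r ≤ n * (m * t₁) ^ 2 / (2 * (cX ^ 2 * cM ^ 2) ^ 2))
    (hr₂ : r ≤ n * (μ₀ * t₂ / 2) ^ 2 / (2 * (cX * cM * (cX * ∑ i, |bstar i|)) ^ 2))
    (hr₃ : r ≤ n * (μ₀ * t₂ / 2) ^ 2 / (2 * ((cX * cM) ^ 2 * (σ : ℝ) ^ 2))) :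
    ∃ E : Set Ω, MeasurableSet E ∧ 1 - 6 * (p : ℝ) ^ 2 * Real.exp (-r) ≤ P.real E ∧
      ∀ ω ∈ E, (∀ i j, |M i ω j| ≤ cM) ∧
        (∀ j k, |sigmaHat (corrupted X M ω) SM muM j k - gram X j k| ≤ t₁) ∧
        ∀ j, |xiHat (corrupted X M ω) (response X bstar e ω) muM j - (gram X *ᵥ bstar) j| ≤ t₂ := by
  -- A null set, removed so that the bound on `M` holds at every outcome of the event.
  set F₀ : Set Ω := {ω | ∃ i j, cM < |M i ω j|} with hF₀
  set F₁ : Fin p × Fin p → Set Ω := fun jk =>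
    {ω | t₁ ≤ |sigmaHat (corrupted X M ω) SM muM jk.1 jk.2 - gram X jk.1 jk.2|} with hF₁
  set F₂ : Fin p → Set Ω := fun j =>
    {ω | t₂ ≤ |xiHat (corrupted X M ω) (response X bstar e ω) muM j - (gram X *ᵥ bstar) j|}
    with hF₂
  have hm₀ : MeasurableSet F₀ := by
    simp only [hF₀, Set.ofPred_exists]
    exact MeasurableSet.iUnion fun i => MeasurableSet.iUnion fun j =>
      measurableSet_lt measurable_const (h.measurable_M_apply i j).abs
  have hm₁ : ∀ jk, MeasurableSet (F₁ jk) := fun jk =>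
    measurableSet_le measurable_const ((h.measurable_sigmaHat jk.1 jk.2).sub_const _).abs
  have hm₂ : ∀ j, MeasurableSet (F₂ j) := fun j =>
    measurableSet_le measurable_const ((h.measurable_xiHat j).sub_const _).abs
  have hm : MeasurableSet (F₀ ∪ ((⋃ jk, F₁ jk) ∪ ⋃ j, F₂ j)) :=
    hm₀.union ((MeasurableSet.iUnion hm₁).union (MeasurableSet.iUnion hm₂))
  have hP₀ : P.real F₀ = 0 := by
    rw [measureReal_eq_zero_iff]
    refine measure_mono_null (fun ω hω => ?_) (ae_iff.1 h.M_bdd)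
    simpa [hF₀] using hω
  have hexp : ∀ {x : ℝ}, r ≤ x → 2 * Real.exp (-x) ≤ 2 * Real.exp (-r) := fun hx =>
    mul_le_mul_of_nonneg_left (Real.exp_le_exp.2 (neg_le_neg hx)) (by norm_num)
  have hP₁ : P.real (⋃ jk, F₁ jk) ≤ (p : ℝ) ^ 2 * (2 * Real.exp (-r)) := by
    refine (measureReal_iUnion_fintype_le _).trans ((Finset.sum_le_sum fun jk _ =>
      (h.sigmaHat_tail jk.1 jk.2 ht₁).trans (hexp hr₁)).trans_eq ?_)
    simp [sq]
  have hP₂ : P.real (⋃ j, F₂ j) ≤ (p : ℝ) * (4 * Real.exp (-r)) := by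
    refine (measureReal_iUnion_fintype_le _).trans ((Finset.sum_le_sum fun j _ =>
      (h.xiHat_tail j ht₂).trans (add_le_add (hexp hr₂) (hexp hr₃))).trans_eq ?_)
    simp only [Finset.sum_const, Finset.card_univ, Fintype.card_fin, nsmul_eq_mul]
    ring
  refine ⟨(F₀ ∪ ((⋃ jk, F₁ jk) ∪ ⋃ j, F₂ j))ᶜ, hm.compl, ?_, fun ω hω => ?_⟩
  · rw [probReal_compl_eq_one_sub hm]
    have h1 := measureReal_union_le (μ := P) F₀ ((⋃ jk, F₁ jk) ∪ ⋃ j, F₂ j)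
    have h2 := measureReal_union_le (μ := P) (⋃ jk, F₁ jk) (⋃ j, F₂ j)
    -- The union bound totals `2p² + 4p ≤ 6p²`.
    have hp : (p : ℝ) ≤ (p : ℝ) ^ 2 := by
      exact_mod_cast Nat.le_self_pow two_ne_zero p
    have h3 := mul_le_mul_of_nonneg_right hp (by positivity : 0 ≤ 4 * Real.exp (-r))
    linarith
  · simp only [Set.mem_compl_iff, Set.mem_union, Set.mem_iUnion, not_or, not_exists, hF₀, hF₁, hF₂,
      Set.mem_ofPred_eq, not_lt, not_le] at hω
    exact ⟨hω.1, fun j k => (hω.2.1 (j, k)).le, fun j => (hω.2.2 j).le⟩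

theorem corollary4 :
    ∃ C c : ℝ, 0 < C ∧ 0 < c ∧
    -- `ζ` of: nonzero entries of `β*`, `τ²`, `σ²`, `κ`, `λ_min(Σ_M†)`, `c_X, c_M, m, μ₀`, and `ε`
    ∃ ζ : Multiset ℝ → ℝ≥0 → ℝ≥0 → ℝ → ℝ → ℝ → ℝ → ℝ → ℝ → ℝ → ℝ,
    (∀ B τ2 σ2 κ l cX cM m μ₀ ε, 0 < ζ B τ2 σ2 κ l cX cM m μ₀ ε) ∧
    ∀ (Ω : Type*) [MeasurableSpace Ω] (P : Measure Ω) [IsProbabilityMeasure P] (n p : ℕ)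
      (X : Matrix (Fin n) (Fin p) ℝ) (M : Fin n → Ω → Fin p → ℝ) (e : Fin n → Ω → ℝ)
      (bstar muM : Fin p → ℝ) (SM : Matrix (Fin p) (Fin p) ℝ) (τ σ : ℝ≥0)
      (cX cM m μ₀ ε κ : ℝ),
      bstar ≠ 0 → 0 < ε →
      MulErrorModel P X M e muM SM τ σ cX cM m μ₀ →
      REC (gram X) (supp bstar) κ →
      ∃ E : Set Ω, MeasurableSet E ∧
        1 - C * (p : ℝ) ^ 2 * Real.exp (-(c * n * ((supp bstar).card : ℝ) ^ (-2 : ℤ) *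
          (ζ (nonzeroEntries bstar) (τ ^ 2) (σ ^ 2) κ (lamMin (sigmaDagger SM muM))
            cX cM m μ₀ ε)⁻¹)) ≤ P.real E ∧
        ∀ ω ∈ E, EventuallyOracle (corrupted X M ω) (response X bstar e ω) bstar muM SM cM ε κ := by
  -- Half of the calibration error `ε - l`: the errors of `sigmaHat` and `xiHat` receive one half
  -- each. The `κ / 48` below comes from `24 s t₁ ≤ κ/2` with `t₁ = u/s`.
  let δ : ℝ → ℝ → ℝ → ℝ := fun ε l cM => (ε - min l 0 * cM ^ 2) / 2
  let N : Multiset ℝ → ℝ := fun B => (B.map fun x => |x|).sum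
  let ζ₁ : ℝ → ℝ → ℝ → ℝ → ℝ → ℝ → ℝ := fun κ l cX cM m ε =>
    2 * (cX ^ 2 * cM ^ 2) ^ 2 / (m * min (δ ε l cM) (κ / 48)) ^ 2
  let ζ₂ : Multiset ℝ → ℝ → ℝ → ℝ → ℝ → ℝ → ℝ := fun B l cX cM μ₀ ε =>
    2 * (cX * cM * (cX * N B)) ^ 2 / (μ₀ * (δ ε l cM * N B) / 2) ^ 2
  let ζ₃ : Multiset ℝ → ℝ≥0 → ℝ → ℝ → ℝ → ℝ → ℝ → ℝ := fun B σ2 l cX cM μ₀ ε =>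
    2 * ((cX * cM) ^ 2 * (σ2 : ℝ)) / (μ₀ * (δ ε l cM * N B) / 2) ^ 2
  -- Summing the reciprocal rates makes ζ dominate each. The added `1` keeps ζ positive for
  -- arbitrary arguments, where the quotients may vanish.
  refine ⟨6, 1, by norm_num, one_pos, fun B _ σ2 κ l cX cM m μ₀ ε =>
    1 + ζ₁ κ l cX cM m ε + ζ₂ B l cX cM μ₀ ε + ζ₃ B σ2 l cX cM μ₀ ε, ?_, ?_⟩
  · intro B _ σ2 κ l cX cM m μ₀ ε
    positivity
  intro Ω _ P _ n p X M e bstar muM SM τ σ cX cM m μ₀ ε κ hbstar hε h hRE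
  have hS := supp_nonempty hbstar
  obtain ⟨j, hj⟩ := hS
  have hn := h.n_pos j
  have hn' : (0 : ℝ) < n := by exact_mod_cast hn
  have hcX := h.cX_pos j
  have hcM := h.cM_pos j
  have hσ : (0 : ℝ) < σ := h.sigma_pos
  have hm := h.m_pos
  have hμ₀ := h.mu_pos
  have hκ := hRE.1
  set s : ℝ := ((supp bstar).card : ℝ) with hs
  have hs1 : 1 ≤ s := Nat.one_le_cast.2 (supp_nonempty hbstar).card_pos
  have hs0 : 0 < s := by linarith
  set l := lamMin (sigmaDagger SM muM) with hl
  have hNB : N (nonzeroEntries bstar) = ∑ i, |bstar i| := sum_abs_nonzeroEntries bstar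
  set b₁ := ∑ i, |bstar i| with hb₁
  have hb₁0 : 0 < b₁ := by
    have hj' : bstar j ≠ 0 := by simpa [supp] using hj
    exact (abs_pos.2 hj').trans_le
      (Finset.single_le_sum (fun i _ => abs_nonneg (bstar i)) (Finset.mem_univ j))
  have hδ0 : 0 < δ ε l cM := by
    have : min l 0 * cM ^ 2 ≤ 0 :=
      mul_nonpos_of_nonpos_of_nonneg (min_le_right _ _) (sq_nonneg _)
    have : 0 < ε - min l 0 * cM ^ 2 := by linarith
    exact half_pos this
  have hδ2 : 2 * δ ε l cM = ε - min l 0 * cM ^ 2 := by simp only [δ]; ring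
  set d := δ ε l cM with hd
  set u := min d (κ / 48) with hu
  have hu0 : 0 < u := lt_min hδ0 (by positivity)
  have hz₁ : ζ₁ κ l cX cM m ε = 2 * (cX ^ 2 * cM ^ 2) ^ 2 / (m * u) ^ 2 := rfl
  have hz₂ : ζ₂ (nonzeroEntries bstar) l cX cM μ₀ ε =
      2 * (cX * cM * (cX * b₁)) ^ 2 / (μ₀ * (d * b₁) / 2) ^ 2 := by simp only [ζ₂, hNB, ← hd]
  have hz₃ : ζ₃ (nonzeroEntries bstar) (σ ^ 2) l cX cM μ₀ ε =
      2 * ((cX * cM) ^ 2 * (σ : ℝ) ^ 2) / (μ₀ * (d * b₁) / 2) ^ 2 := by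
    simp only [ζ₃, hNB, ← hd, NNReal.coe_pow]
  have hz₁0 : 0 < ζ₁ κ l cX cM m ε := by rw [hz₁]; positivity
  have hz₂0 : 0 < ζ₂ (nonzeroEntries bstar) l cX cM μ₀ ε := by rw [hz₂]; positivity
  have hz₃0 : 0 < ζ₃ (nonzeroEntries bstar) (σ ^ 2) l cX cM μ₀ ε := by rw [hz₃]; positivity
  set z := 1 + ζ₁ κ l cX cM m ε + ζ₂ (nonzeroEntries bstar) l cX cM μ₀ ε +
    ζ₃ (nonzeroEntries bstar) (σ ^ 2) l cX cM μ₀ ε with hz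
  have hs2 : s ^ (-2 : ℤ) ≤ 1 := zpow_le_one_of_nonpos₀ hs1 (by norm_num)
  have hrate : ∀ {x : ℝ}, 0 < x → x ≤ z → 1 * n * s ^ (-2 : ℤ) * z⁻¹ ≤ n * s ^ (-2 : ℤ) * x⁻¹ :=
    fun hx hxz => by
      rw [one_mul]
      exact mul_le_mul_of_nonneg_left (inv_anti₀ hx hxz) (by positivity)
  -- The deviation of `xiHat` is not scaled by `1/s`, so its rates have `s⁻²` to spare.
  have hrate' : ∀ {x : ℝ}, 0 < x → x ≤ z → 1 * n * s ^ (-2 : ℤ) * z⁻¹ ≤ n * x⁻¹ :=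
    fun hx hxz => (hrate hx hxz).trans (mul_le_mul_of_nonneg_right
      (mul_le_of_le_one_right hn'.le hs2) (inv_nonneg.2 hx.le))
  obtain ⟨E, hE, hPE, hgood⟩ := h.exists_good_event bstar (t₁ := u / s) (t₂ := d * b₁)
    (r := 1 * n * s ^ (-2 : ℤ) * z⁻¹) (by positivity) (by positivity)
    (by
      refine (hrate hz₁0 (by linarith)).trans_eq ?_
      rw [hz₁, zpow_neg, inv_div, show s ^ (2 : ℤ) = s ^ 2 from zpow_natCast s 2]
      field_simp)
    (by
      refine (hrate' hz₂0 (by linarith)).trans_eq ?_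
      rw [hz₂, inv_div]
      exact (mul_div_assoc _ _ _).symm)
    (by
      refine (hrate' hz₃0 (by linarith)).trans_eq ?_
      rw [hz₃, inv_div]
      exact (mul_div_assoc _ _ _).symm)
  refine ⟨E, hE, hPE, fun ω hω => ?_⟩
  obtain ⟨hM, h₁, h₂⟩ := hgood ω hω
  refine eventuallyOracle_of_close hn hbstar hε h.secondMoment_symm hRE (fun k => ?_) h₁ h₂
    (by positivity) ?_ ?_
  · calc 1 / (n : ℝ) * ∑ i, corrupted X M ω i k ^ 2
        ≤ 1 / (n : ℝ) * ∑ i, cM ^ 2 * X i k ^ 2 := by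
          refine mul_le_mul_of_nonneg_left (Finset.sum_le_sum fun i _ => ?_) (by positivity)
          rw [corrupted_apply, mul_pow, mul_comm]
          exact mul_le_mul_of_nonneg_right
            (sq_le_sq' (abs_le.1 (hM i k)).1 (abs_le.1 (hM i k)).2) (sq_nonneg _)
      _ = cM ^ 2 * (1 / (n : ℝ) * ∑ i, X i k ^ 2) := by rw [← Finset.mul_sum]; ring
      _ = cM ^ 2 := by rw [h.normalized, mul_one]
  · have : u ≤ κ / 48 := min_le_right _ _
    rw [show 24 * s * (u / s) = 24 * u by field_simp]
    linarith
  · have h3 : u / s ≤ d := (div_le_self hu0.le hs1).trans (min_le_left _ _)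
    have h4 := mul_le_mul_of_nonneg_right h3 hb₁0.le
    rw [← hδ2]
    linarith
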